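/- Let $w\in(0,1)$ and $\Delta\in(0,1]$. For a probability measure $\mu$ on $[0,1]$ and a bounded measurable $h:[0,1]\to\mathbb{R}$ put $$\mathcal A(\mu)h(x)=2\int_{[0,1]}\big[h(wx+(1-w)y)-h(x)\big]\mathbf 1_{\{|x-y|\le\Delta\}}\,\mu(dy),\qquad x\in[0,1].$$ A family $m=(m(t),t\in\mathbb{R}_+)$ of probability measures on $[0,1]$ is a solution to Problem 1 with initial value $m_0\in\mathcal P[0,1]$ if $m(0)=m_0$ and, for all $t\ge 0$ and all bounded measurable $h:[0,1]\to\mathbb{R}$, the function $s\mapsto\langle\mathcal A(m(s))h,m(s)\rangle$ is integrable on $[0,t]$ and $$\langle h,m(t)\rangle-\langle h,m(0)\rangle=\int_0^t\langle \mathcal A(m(s))h,m(s)\rangle\,ds .$$ Let $|\mu-\nu|=\sup\{\langle\phi,\mu\rangle-\langle\phi,\nu\rangle:\phi\text{ measurable},\ \|\phi\|_\infty\le1\}$ be the total variation distance. Let $D(\mathbb{R}_+,[0,1])$ be the space of right-continuous paths with left-hand limits from $\mathbb{R}_+$ to $[0,1]$, with the product $\sigma$-field and the canonical process $X=(X_t)_{t\ge0}$.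 A probability measure $Q$ on $D(\mathbb{R}_+,[0,1])$ is called the law of an inhomogeneous Markov process with generator $\mathcal A(m(t))$ at time $t$ and initial law $m_0$ if, under $Q$, $X_0$ has law $m_0$, $X$ has the Markov property with respect to its natural filtration, and for every bounded measurable $h$ the process $h(X_t)-h(X_0)-\int_0^t\mathcal A(m(s))h(X_s)\,ds$ is a martingale for that filtration. **Theorem.** 1. For every $m_0\in\mathcal P[0,1]$ there is a unique solution $m=(m(t),t\in\mathbb{R}_+)$ to Problem 1 with initial value $m_0$. The map $t\mapsto m(t)$ is continuous for the total variation distance. The map $m_0\mapsto(m(t),t\in\mathbb{R}_+)$ is continuous, for the total variation distance on the initial values and uniform convergence in total variation on bounded time sets for the solutions: for all $m_0$, $T\ge0$ and $\varepsilon>0$ there is $\delta>0$ such that, if $|m_0'-m_0|<\delta$ and $m'$ is the solution with initial value $m_0'$, then $|m'(t)-m(t)|<\varepsilon$ for all $t\in[0,T]$. 2. For every $m_0\in\mathcal P[0,1]$, with $m$ the solution to Problem 1 with initial value $m_0$, there is a unique law $Q$ on $D(\mathbb{R}_+,[0,1])$ of an inhomogeneous Markov process with generator $\mathcal A(m(t))$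 at time $t$ and initial law $m_0$. Its marginal at each time $t\ge 0$ is $Q_t=m(t)$. -/

import Mathlib

open MeasureTheory ProbabilityTheory Filter Topology
open scoped NNReal

noncomputable section

namespace Deffuant

/-- The space of opinions `[0,1]`, with its usual topology and Borel σ-field. -/
abbrev Opinion : Type := unitInterval

/-- `w x + (1 - w) y`, the new opinion of a peer with opinion `x` after meeting opinion `y`. -/
def mix (w x y : Opinion) : Opinion :=
  ⟨w * x + (1 - w) * y, by
    have hw0 := w.2.1
    have hw1 := w.2.2
    refine ⟨add_nonneg (mul_nonneg hw0 x.2.1) (mul_nonneg (by linarith) y.2.1), ?_⟩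
    nlinarith [mul_le_mul_of_nonneg_left x.2.2 hw0,
      mul_le_mul_of_nonneg_left y.2.2 (sub_nonneg.2 hw1)]⟩

/-- Bounded measurable real functions on a measurable space. -/
def IsBoundedMeasurable {S : Type*} [MeasurableSpace S] (h : S → ℝ) : Prop :=
  Measurable h ∧ ∃ C : ℝ, ∀ x, |h x| ≤ C

/-- The generator
`𝒜(μ) h (x) = 2 ∫ [h (w x + (1 - w) y) - h x] 1_{|x - y| ≤ Δ} μ(dy)`. -/
def generator (w : Opinion) (Δ : ℝ) (μ : ProbabilityMeasure Opinion)
    (h : Opinion → ℝ) (x : Opinion) : ℝ :=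
  2 * ∫ y, Set.indicator {y : Opinion | |(x : ℝ) - (y : ℝ)| ≤ Δ}
    (fun y => h (mix w x y) - h x) y ∂(μ : Measure Opinion)

/-- `m` solves Problem 1 with initial value `m₀`: the initial value is `m₀`, and
`⟨h, m(t)⟩ - ⟨h, m(0)⟩ = ∫₀ᵗ ⟨𝒜(m(s)) h, m(s)⟩ ds` for all `t ≥ 0` and all bounded measurable `h`,
the time integral being that of a Lebesgue integrable function. -/
def IsSolution (w : Opinion) (Δ : ℝ) (m₀ : ProbabilityMeasure Opinion)
    (m : ℝ≥0 → ProbabilityMeasure Opinion) : Prop :=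
  m 0 = m₀ ∧
  ∀ h : Opinion → ℝ, IsBoundedMeasurable h → ∀ t : ℝ≥0,
    IntervalIntegrable
      (fun s : ℝ => ∫ x, generator w Δ (m s.toNNReal) h x ∂(m s.toNNReal : Measure Opinion))
      volume 0 t ∧
    (∫ x, h x ∂(m t : Measure Opinion)) - ∫ x, h x ∂(m 0 : Measure Opinion) =
      ∫ s in (0 : ℝ)..t,
        ∫ x, generator w Δ (m s.toNNReal) h x ∂(m s.toNNReal : Measure Opinion)

/-- The total variation distance
`|μ - ν| = sup {⟨φ, μ⟩ - ⟨φ, ν⟩ : φ measurable, ‖φ‖_∞ ≤ 1}` (a supremum of a nonempty set of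
reals that is bounded above by `2`). -/
def tvDist {S : Type*} [MeasurableSpace S] (μ ν : ProbabilityMeasure S) : ℝ :=
  sSup {r : ℝ | ∃ φ : S → ℝ, Measurable φ ∧ (∀ x, |φ x| ≤ 1) ∧
    r = (∫ x, φ x ∂(μ : Measure S)) - ∫ x, φ x ∂(ν : Measure S)}

/-- Right-continuous paths with left-hand limits. -/
def IsCadlag {S : Type*} [TopologicalSpace S] (x : ℝ≥0 → S) : Prop :=
  ∀ t : ℝ≥0, ContinuousWithinAt x (Set.Ici t) t ∧ ∃ l : S, Tendsto x (𝓝[<] t) (𝓝 l)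

/-- The space `D(ℝ₊, S)`; its σ-field is the trace of the product σ-field. -/
abbrev SkorokhodSpace (S : Type*) [TopologicalSpace S] : Type _ :=
  {x : ℝ≥0 → S // IsCadlag x}

/-- The coordinate `X_t` of the canonical process on `D(ℝ₊, [0,1])`. -/
def coord (t : ℝ≥0) (x : SkorokhodSpace Opinion) : Opinion := x.1 t

theorem measurable_coord (t : ℝ≥0) : Measurable (coord t) :=
  (measurable_pi_apply t).comp measurable_subtype_coe

/-- The natural filtration `σ(X_u, u ≤ t)` of the canonical process. -/
def canonicalFiltration :
    Filtration ℝ≥0 (inferInstance : MeasurableSpace (SkorokhodSpace Opinion)) :=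
  Filtration.natural coord fun t => (measurable_coord t).stronglyMeasurable

/-- `Q` is the law on `D(ℝ₊, [0,1])` of an inhomogeneous Markov process with initial law `m₀` and
generator `A t` at time `t`: under `Q` the canonical process `X` starts from `m₀`, has the Markov
property with respect to its natural filtration, and
`h(X_t) - h(X_0) - ∫₀ᵗ (A s h)(X_s) ds` is a martingale for every bounded measurable `h`. -/
structure IsMarkovLaw (A : ℝ≥0 → (Opinion → ℝ) → Opinion → ℝ)
    (m₀ : ProbabilityMeasure Opinion)
    (Q : ProbabilityMeasure (SkorokhodSpace Opinion)) : Prop where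
  initial : (Q : Measure (SkorokhodSpace Opinion)).map (coord 0) = (m₀ : Measure Opinion)
  markov : ∀ h : Opinion → ℝ, IsBoundedMeasurable h → ∀ s t : ℝ≥0, s ≤ t →
    (Q : Measure (SkorokhodSpace Opinion))[fun x => h (coord t x) | canonicalFiltration s]
      =ᵐ[(Q : Measure (SkorokhodSpace Opinion))]
    (Q : Measure (SkorokhodSpace Opinion))[fun x => h (coord t x) |
      MeasurableSpace.comap (coord s) inferInstance]
  generator : ∀ h : Opinion → ℝ, IsBoundedMeasurable h →
    Martingale
      (fun (t : ℝ≥0) (x : SkorokhodSpace Opinion) =>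
        h (coord t x) - h (coord 0 x)
          - ∫ s in (0 : ℝ)..t, A s.toNNReal h (coord s.toNNReal x))
      canonicalFiltration (Q : Measure (SkorokhodSpace Opinion))

end Deffuant

end

noncomputable section

namespace Deffuant

/-! ### Grönwall's inequality for functionals of bounded functions -/

section Gronwall

/-! Let J(x, y) be the state reached from x after meeting y, with J(x, y) = x when |x - y| > Δ. Then
𝒜(μ)h(x) = 2(∫ h(J(x, y)) μ(dy) - h(x)): jumps, some of them fictitious, occur at the constant rate
2, and Problem 1 is the weak form of m' = 2(m∘m - m), where the bilinear μ∘ν (`collision`) is the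
law of J under μ ⊗ ν.

Linearizing this quadratic term around two solutions gives for their difference a linear equation
whose operator sends functions bounded by C to functions bounded by 6C. Iterating it in time
(`gronwall_functional`) yields |m(t) - m'(t)| ≤ e^{6t} |m₀ - m₀'|, hence uniqueness and continuity
in the initial value; continuity in time is the uniform bound on 𝒜. For existence put τ = 1 -
e^{-2t} and u = e^{2t} m: the equation becomes du/dτ = u∘u, solved by the power series whose
coefficient W_{n+1} is the average of the W_k∘W_{n-k}. The weights (1 - τ)τⁿ in m make it a
probability measure (`isSolution_wildSolution`).

For the Markov process, m is frozen in the generator A_t = 𝒜(m(t)). The equation d/dt ν_t(h) =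
ν_t(A_t h) is linear, and its bounded solutions are determined by their initial value
(`IsLinearFlow.unique`). Under a solution of the martingale problem, r ↦ E[ξ h(X_{s+r})] satisfies
it, shifted by s, for every bounded ξ known at time s (`isLinearFlow_weighted`). The weight ξ = 1
identifies the marginals, products of functions of past coordinates give the finite-dimensional laws
and so uniqueness, and the comparison of 1_B with E[1_B | X_s] gives the Markov property.

Existence is by construction: independent exponential waiting times of rate 2 and uniform marks u,
with a jump at time t from z to J(z, Y_t(u)), where Y_t carries the uniform law to m(t). The Dynkin
increment is a sum over the jumps, and each term is centered given the earlier noise because 2 E∫₀ᴱ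
g = E g(E) for an exponential time E of rate 2 (`integral_jumpIncrement_update`). -/

theorem integral_pow_div_factorial (l t : ℝ) (n : ℕ) :
    ∫ r in (0 : ℝ)..t, l * ((l * r) ^ n / n.factorial) = (l * t) ^ (n + 1) / (n + 1).factorial := by
  have h1 : ∀ r : ℝ, l * ((l * r) ^ n / n.factorial) = (l ^ (n + 1) / n.factorial) * r ^ n := by
    intro r; rw [mul_pow, pow_succ]; ring
  simp_rw [h1]
  rw [intervalIntegral.integral_const_mul, integral_pow, Nat.factorial_succ, mul_pow]
  have : (n.factorial : ℝ) ≠ 0 := by positivity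
  push_cast
  field_simp
  simp

theorem integral_mul_exp (l t : ℝ) :
    ∫ r in (0 : ℝ)..t, l * Real.exp (l * r) = Real.exp (l * t) - 1 := by
  have h : ∀ r ∈ Set.uIcc (0 : ℝ) t,
      HasDerivAt (fun r => Real.exp (l * r)) (l * Real.exp (l * r)) r := by
    intro r _
    have := ((hasDerivAt_id r).const_mul l).exp
    simpa [mul_comm] using this
  rw [intervalIntegral.integral_eq_sub_of_hasDerivAt h
    (Continuous.intervalIntegrable (by fun_prop) _ _)]
  simp

/-- A Grönwall inequality for a family of functionals `L t` on bounded measurable functions. -/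
theorem gronwall_functional {S : Type*} [MeasurableSpace S] {L : ℝ → (S → ℝ) → ℝ} {K l δ : ℝ}
    (hl : 0 ≤ l) (hδ : 0 ≤ δ)
    (hK : ∀ t h C, 0 ≤ t → Measurable h → (∀ x, |h x| ≤ C) → 0 ≤ C → |L t h| ≤ K * C)
    (hL : ∀ h C, Measurable h → (∀ x, |h x| ≤ C) → 0 ≤ C → ∃ g : ℝ → S → ℝ,
      (∀ r, 0 ≤ r → Measurable (g r) ∧ ∀ x, |g r x| ≤ l * C) ∧
      ∀ t, 0 ≤ t → |L t h - ∫ r in (0 : ℝ)..t, L r (g r)| ≤ δ * C)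
    {t : ℝ} (ht : 0 ≤ t) {h : S → ℝ} {C : ℝ} (hh : Measurable h) (hC : ∀ x, |h x| ≤ C)
    (hC₀ : 0 ≤ C) : |L t h| ≤ δ * C * Real.exp (l * t) := by
  -- The estimate has to hold for all functions at once, as `g r` differs from `h` and varies with
  -- `r`. Each round replaces the crude bound `K` by the next term of an exponential series, which
  -- tends to `0`.
  have key : ∀ n : ℕ, ∀ t h C, 0 ≤ t → Measurable h → (∀ x, |h x| ≤ C) → 0 ≤ C →
      |L t h| ≤ C * (δ * Real.exp (l * t) + K * ((l * t) ^ n / n.factorial)) := by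
    intro n
    induction n with
    | zero =>
      intro t h C ht hh hC hC₀
      refine (hK t h C ht hh hC hC₀).trans ?_
      have : 0 ≤ δ * Real.exp (l * t) := by positivity
      simp
      nlinarith
    | succ n ih =>
      intro t h C ht hh hC hC₀
      obtain ⟨g, hg, hgt⟩ := hL h C hh hC hC₀
      have h1 := hgt t ht
      have h2 : |∫ r in (0 : ℝ)..t, L r (g r)| ≤
          ∫ r in (0 : ℝ)..t, (C * δ * (l * Real.exp (l * r))
            + C * K * (l * ((l * r) ^ n / n.factorial))) := by
        rw [← Real.norm_eq_abs]
        -- Only the majorant has to be integrable: the integral of a non-integrable function is `0`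
        -- by convention.
        refine intervalIntegral.norm_integral_le_of_norm_le ht ?_ ?_
        · refine Eventually.of_forall fun r hr => ?_
          rw [Real.norm_eq_abs]
          refine (ih r (g r) (l * C) hr.1.le (hg r hr.1.le).1 (hg r hr.1.le).2
            (by positivity)).trans (le_of_eq ?_)
          ring
        · exact Continuous.intervalIntegrable (by fun_prop) _ _
      -- The exponential integrates to `exp (l * t) - 1`, and the `-1` absorbs the error `δ * C` of
      -- this round.
      rw [intervalIntegral.integral_add (Continuous.intervalIntegrable (by fun_prop) _ _)
        (Continuous.intervalIntegrable (by fun_prop) _ _),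
        intervalIntegral.integral_const_mul (C * δ), intervalIntegral.integral_const_mul (C * K),
        integral_pow_div_factorial, integral_mul_exp] at h2
      have h3 : |L t h| ≤ |L t h - ∫ r in (0 : ℝ)..t, L r (g r)|
          + |∫ r in (0 : ℝ)..t, L r (g r)| := by
        simpa using abs_add_le (L t h - ∫ r in (0 : ℝ)..t, L r (g r)) (∫ r in (0 : ℝ)..t, L r (g r))
      linarith
  have hlim : Tendsto (fun n : ℕ =>
      C * (δ * Real.exp (l * t) + K * ((l * t) ^ n / n.factorial))) atTop
      (𝓝 (C * (δ * Real.exp (l * t) + K * 0))) :=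
    ((FloorSemiring.tendsto_pow_div_factorial_atTop (l * t)).const_mul K |>.const_add _).const_mul C
  have := ge_of_tendsto' hlim fun n => key n t h C ht hh hC hC₀
  linarith

end Gronwall

/-! ### The generator as a constant-rate jump operator -/

section Basic

/-- The opinion of a peer with opinion `x` after meeting a peer with opinion `y`. -/
def jump (w : Opinion) (Δ : ℝ) (x y : Opinion) : Opinion :=
  if |(x : ℝ) - (y : ℝ)| ≤ Δ then mix w x y else x

theorem measurable_jump (w : Opinion) (Δ : ℝ) :
    Measurable fun p : Opinion × Opinion => jump w Δ p.1 p.2 := by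
  unfold jump
  refine Measurable.ite ?_ ?_ measurable_fst
  · exact measurableSet_le (by fun_prop) measurable_const
  · unfold mix
    refine Measurable.subtype_mk ?_
    fun_prop

theorem IsBoundedMeasurable.integrable {S : Type*} [MeasurableSpace S] {h : S → ℝ}
    (hh : IsBoundedMeasurable h) (μ : Measure S) [IsFiniteMeasure μ] : Integrable h μ := by
  obtain ⟨hm, C, hC⟩ := hh
  exact Integrable.of_bound hm.aestronglyMeasurable C (Eventually.of_forall hC)

theorem abs_integral_le_of_abs_le {S : Type*} [MeasurableSpace S] {h : S → ℝ} {C : ℝ}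
    (hC : ∀ x, |h x| ≤ C) (μ : Measure S) [IsProbabilityMeasure μ] : |∫ x, h x ∂μ| ≤ C := by
  have := norm_integral_le_of_norm_le_const (μ := μ) (f := h) (C := C) (Eventually.of_forall hC)
  simpa using this

variable {w : Opinion} {Δ : ℝ} {h : Opinion → ℝ} {C : ℝ}

theorem measurable_comp_jump (hh : Measurable h) :
    Measurable fun p : Opinion × Opinion => h (jump w Δ p.1 p.2) :=
  hh.comp (measurable_jump w Δ)

theorem integrable_comp_jump (hh : Measurable h) (hC : ∀ x, |h x| ≤ C) (μ : Measure Opinion)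
    [IsFiniteMeasure μ] (x : Opinion) : Integrable (fun y => h (jump w Δ x y)) μ :=
  IsBoundedMeasurable.integrable
    ⟨(measurable_comp_jump hh).comp measurable_prodMk_left, C, fun _ => hC _⟩ μ

/-- Where |x - y| > Δ the jump leads from x to x and contributes nothing, so the indicator is
absorbed into `jump` and the jump rate no longer depends on the state. -/
theorem generator_eq (hh : Measurable h) (hC : ∀ x, |h x| ≤ C) (μ : ProbabilityMeasure Opinion)
    (x : Opinion) :
    generator w Δ μ h x = 2 * ((∫ y, h (jump w Δ x y) ∂(μ : Measure Opinion)) - h x) := by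
  have h1 : ∀ y, Set.indicator {y : Opinion | |(x : ℝ) - (y : ℝ)| ≤ Δ}
    (fun y => h (mix w x y) - h x) y = h (jump w Δ x y) - h x := by
    intro y
    by_cases hy : |(x : ℝ) - (y : ℝ)| ≤ Δ
    · rw [Set.indicator_of_mem (by exact hy), jump, if_pos hy]
    · rw [Set.indicator_of_notMem (by exact hy), jump, if_neg hy, sub_self]
  unfold generator
  simp_rw [h1]
  rw [integral_sub (integrable_comp_jump hh hC _ x) (integrable_const _)]
  simp

theorem abs_generator_le (hh : Measurable h) (hC : ∀ x, |h x| ≤ C)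
    (μ : ProbabilityMeasure Opinion) (x : Opinion) : |generator w Δ μ h x| ≤ 4 * C := by
  rw [generator_eq hh hC, abs_mul, abs_two]
  have h1 : |∫ y, h (jump w Δ x y) ∂(μ : Measure Opinion)| ≤ C :=
    abs_integral_le_of_abs_le (fun _ => hC _) _
  have h2 := abs_sub (∫ y, h (jump w Δ x y) ∂(μ : Measure Opinion)) (h x)
  linarith [hC x]

theorem measurable_generator (hh : Measurable h) (hC : ∀ x, |h x| ≤ C)
    (μ : ProbabilityMeasure Opinion) : Measurable (generator w Δ μ h) := by
  have h1 : generator w Δ μ h = fun x =>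
      2 * ((∫ y, h (jump w Δ x y) ∂(μ : Measure Opinion)) - h x) :=
    funext fun x => generator_eq hh hC μ x
  rw [h1]
  have h2 : StronglyMeasurable fun x => ∫ y, h (jump w Δ x y) ∂(μ : Measure Opinion) :=
    (measurable_comp_jump hh).stronglyMeasurable.integral_prod_right
  exact (h2.measurable.sub hh).const_mul 2

theorem measurable_integral_jump_left (hh : Measurable h) (μ : ProbabilityMeasure Opinion) :
    Measurable fun x => ∫ y, h (jump w Δ y x) ∂(μ : Measure Opinion) :=
  (measurable_comp_jump hh).stronglyMeasurable.integral_prod_left.measurable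

/-- The quadratic term of Problem 1, linearized around a pair of measures. -/
theorem integral_generator_sub (hh : Measurable h) (hC : ∀ x, |h x| ≤ C)
    (μ ν : ProbabilityMeasure Opinion) :
    (∫ x, generator w Δ μ h x ∂(μ : Measure Opinion))
        - ∫ x, generator w Δ ν h x ∂(ν : Measure Opinion) =
      (∫ x, (generator w Δ μ h x + 2 * ∫ y, h (jump w Δ y x) ∂(ν : Measure Opinion))
          ∂(μ : Measure Opinion))
        - ∫ x, (generator w Δ μ h x + 2 * ∫ y, h (jump w Δ y x) ∂(ν : Measure Opinion))
          ∂(ν : Measure Opinion) := by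
  have i1 : ∀ ρ σ : ProbabilityMeasure Opinion,
      Integrable (generator w Δ ρ h) (σ : Measure Opinion) := fun ρ σ =>
    IsBoundedMeasurable.integrable ⟨measurable_generator hh hC ρ, _, abs_generator_le hh hC ρ⟩ _
  have i2 : ∀ ρ σ : ProbabilityMeasure Opinion,
      Integrable (fun x => 2 * ∫ y, h (jump w Δ y x) ∂(ρ : Measure Opinion))
        (σ : Measure Opinion) := fun ρ σ =>
    (IsBoundedMeasurable.integrable ⟨measurable_integral_jump_left hh ρ, C, fun x =>
      abs_integral_le_of_abs_le (fun _ => hC _) _⟩ _).const_mul 2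
  have i3 : ∀ ρ σ : ProbabilityMeasure Opinion,
      Integrable (fun x => ∫ y, h (jump w Δ x y) ∂(ρ : Measure Opinion))
        (σ : Measure Opinion) := fun ρ σ =>
    IsBoundedMeasurable.integrable
      ⟨(measurable_comp_jump hh).stronglyMeasurable.integral_prod_right.measurable, C, fun x =>
        abs_integral_le_of_abs_le (fun _ => hC _) _⟩ _
  have hG : ∀ ρ σ : ProbabilityMeasure Opinion, ∫ x, generator w Δ ρ h x ∂(σ : Measure Opinion) =
      2 * ((∫ x, ∫ y, h (jump w Δ x y) ∂(ρ : Measure Opinion) ∂(σ : Measure Opinion))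
        - ∫ x, h x ∂(σ : Measure Opinion)) := by
    intro ρ σ
    simp_rw [generator_eq hh hC]
    rw [integral_const_mul, integral_sub (i3 _ _)
      (IsBoundedMeasurable.integrable ⟨hh, C, hC⟩ _)]
  -- With B(σ, ρ) = ∫∫ h(J(x, y)) ρ(dy) σ(dx), the claim rests on B(μ, μ) - B(ν, ν) = B(μ - ν, μ) +
  -- B(ν, μ - ν). Fubini writes the last term as a function integrated against μ - ν.
  have hF : ∀ ρ σ : ProbabilityMeasure Opinion,
      ∫ x, ∫ y, h (jump w Δ y x) ∂(ρ : Measure Opinion) ∂(σ : Measure Opinion) =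
      ∫ x, ∫ y, h (jump w Δ x y) ∂(σ : Measure Opinion) ∂(ρ : Measure Opinion) := by
    intro ρ σ
    refine integral_integral_swap (f := fun x y => h (jump w Δ y x)) ?_
    exact IsBoundedMeasurable.integrable
      ⟨(measurable_comp_jump hh).comp measurable_swap, C, fun _ => hC _⟩ _
  rw [integral_add (i1 _ _) (i2 _ _), integral_add (i1 _ _) (i2 _ _), integral_const_mul,
    integral_const_mul, hF, hF, hG, hG, hG]
  ring

end Basic

/-! ### Total variation distance -/

section TotalVariation

variable {S : Type*} [MeasurableSpace S]

theorem tvDist_bddAbove (μ ν : ProbabilityMeasure S) :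
    BddAbove {r : ℝ | ∃ φ : S → ℝ, Measurable φ ∧ (∀ x, |φ x| ≤ 1) ∧
      r = (∫ x, φ x ∂(μ : Measure S)) - ∫ x, φ x ∂(ν : Measure S)} := by
  refine ⟨2, ?_⟩
  rintro r ⟨φ, -, h1, rfl⟩
  have a := abs_le.1 (abs_integral_le_of_abs_le h1 (μ : Measure S))
  have b := abs_le.1 (abs_integral_le_of_abs_le h1 (ν : Measure S))
  linarith [a.2, b.1]

theorem integral_sub_le_tvDist (μ ν : ProbabilityMeasure S) {φ : S → ℝ} (hφ : Measurable φ)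
    (h1 : ∀ x, |φ x| ≤ 1) :
    (∫ x, φ x ∂(μ : Measure S)) - ∫ x, φ x ∂(ν : Measure S) ≤ tvDist μ ν :=
  le_csSup (tvDist_bddAbove μ ν) ⟨φ, hφ, h1, rfl⟩

theorem tvDist_nonneg (μ ν : ProbabilityMeasure S) : 0 ≤ tvDist μ ν := by
  simpa using integral_sub_le_tvDist μ ν (φ := fun _ => 0) measurable_const (by simp)

theorem tvDist_le {μ ν : ProbabilityMeasure S} {c : ℝ}
    (hc : ∀ φ : S → ℝ, Measurable φ → (∀ x, |φ x| ≤ 1) →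
      (∫ x, φ x ∂(μ : Measure S)) - ∫ x, φ x ∂(ν : Measure S) ≤ c) : tvDist μ ν ≤ c := by
  refine csSup_le ⟨_, fun _ => 0, measurable_const, by simp, rfl⟩ ?_
  rintro r ⟨φ, hφ, h1, rfl⟩
  exact hc φ hφ h1

/-- By homogeneity: ±h / C are admissible test functions when C > 0. -/
theorem abs_integral_sub_le_tvDist (μ ν : ProbabilityMeasure S) {h : S → ℝ} {C : ℝ}
    (hh : Measurable h) (hC : ∀ x, |h x| ≤ C) (hC₀ : 0 ≤ C) :
    |(∫ x, h x ∂(μ : Measure S)) - ∫ x, h x ∂(ν : Measure S)| ≤ tvDist μ ν * C := by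
  rcases hC₀.eq_or_lt with rfl | hpos
  · have : h = fun _ => 0 := funext fun x => abs_nonpos_iff.1 (hC x)
    simp [this]
  have e : ∀ s : ℝ, (∫ x, s * h x / C ∂(μ : Measure S)) - ∫ x, s * h x / C ∂(ν : Measure S) =
      s * ((∫ x, h x ∂(μ : Measure S)) - ∫ x, h x ∂(ν : Measure S)) / C := by
    intro s
    rw [integral_div, integral_div, integral_const_mul, integral_const_mul]
    ring
  have b : ∀ s : ℝ, |s| = 1 → s * ((∫ x, h x ∂(μ : Measure S)) - ∫ x, h x ∂(ν : Measure S)) ≤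
      tvDist μ ν * C := by
    intro s hs
    have := integral_sub_le_tvDist μ ν (φ := fun x => s * h x / C) (by fun_prop) (fun x => by
      rw [abs_div, abs_mul, hs, one_mul, abs_of_pos hpos]
      exact (div_le_one hpos).2 (hC x))
    rwa [e, div_le_iff₀ hpos] at this
  rw [abs_le]
  have b1 := b 1 (by simp)
  have b2 := b (-1) (by simp)
  constructor <;> linarith

theorem ext_of_integral {μ ν : Measure S} [IsFiniteMeasure μ] [IsFiniteMeasure ν]
    (hμν : ∀ h : S → ℝ, Measurable h → (∀ x, |h x| ≤ 1) → ∫ x, h x ∂μ = ∫ x, h x ∂ν) :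
    μ = ν := by
  refine Measure.ext fun s hs => ?_
  have := hμν (s.indicator 1) (measurable_one.indicator hs) (fun x => by
    by_cases hx : x ∈ s <;> simp [hx])
  rw [integral_indicator_one hs, integral_indicator_one hs] at this
  exact (measureReal_eq_measureReal_iff).1 this

end TotalVariation

/-! ### Uniqueness and continuity of solutions -/

section Solution

variable {w : Opinion} {Δ : ℝ} {m₀ m₀' : ProbabilityMeasure Opinion}
  {m m' : ℝ≥0 → ProbabilityMeasure Opinion}

theorem abs_integral_generator_le (w : Opinion) (Δ : ℝ) {h : Opinion → ℝ} {C : ℝ}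
    (hh : Measurable h) (hC : ∀ x, |h x| ≤ C) (μ ν : ProbabilityMeasure Opinion) :
    |∫ x, generator w Δ μ h x ∂(ν : Measure Opinion)| ≤ 4 * C :=
  abs_integral_le_of_abs_le (abs_generator_le hh hC μ) _

/-- The time integrand is bounded by 4C uniformly in time, so solutions are Lipschitz in time. Their
measurability in time follows from this as well. -/
theorem IsSolution.abs_integral_sub_le (hm : IsSolution w Δ m₀ m) {h : Opinion → ℝ} {C : ℝ}
    (hh : Measurable h) (hC : ∀ x, |h x| ≤ C) (s t : ℝ≥0) :
    |(∫ x, h x ∂(m s : Measure Opinion)) - ∫ x, h x ∂(m t : Measure Opinion)| ≤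
      4 * C * |(s : ℝ) - t| := by
  have h1 := hm.2 h ⟨hh, C, hC⟩
  have e : (∫ x, h x ∂(m s : Measure Opinion)) - ∫ x, h x ∂(m t : Measure Opinion) =
      ∫ r in (t : ℝ)..s,
        ∫ x, generator w Δ (m r.toNNReal) h x ∂(m r.toNNReal : Measure Opinion) := by
    rw [← intervalIntegral.integral_interval_sub_left (h1 s).1 (h1 t).1, ← (h1 s).2, ← (h1 t).2]
    ring
  rw [e, ← Real.norm_eq_abs]
  exact intervalIntegral.norm_integral_le_of_norm_le_const fun r _ =>
    abs_integral_generator_le w Δ hh hC _ _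

theorem IsSolution.tvDist_le (hm : IsSolution w Δ m₀ m) (s t : ℝ≥0) :
    tvDist (m s) (m t) ≤ 4 * |(s : ℝ) - t| :=
  Deffuant.tvDist_le fun φ hφ h1 => by
    simpa using (le_abs_self _).trans (hm.abs_integral_sub_le hφ h1 s t)

theorem IsSolution.tendsto_tvDist (hm : IsSolution w Δ m₀ m) (t : ℝ≥0) :
    Tendsto (fun s => tvDist (m s) (m t)) (𝓝 t) (𝓝 0) := by
  refine squeeze_zero (fun s => tvDist_nonneg _ _) (fun s => hm.tvDist_le s t) ?_
  have : Continuous fun s : ℝ≥0 => 4 * |(s : ℝ) - t| := by fun_prop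
  simpa using this.tendsto t

theorem IsSolution.abs_integral_sub_le_exp (hm : IsSolution w Δ m₀ m)
    (hm' : IsSolution w Δ m₀' m') (t : ℝ≥0) {h : Opinion → ℝ} {C : ℝ} (hh : Measurable h)
    (hC : ∀ x, |h x| ≤ C) (hC₀ : 0 ≤ C) :
    |(∫ x, h x ∂(m t : Measure Opinion)) - ∫ x, h x ∂(m' t : Measure Opinion)| ≤
      tvDist m₀ m₀' * C * Real.exp (6 * t) := by
  have key := gronwall_functional (S := Opinion)
    (L := fun t h => (∫ x, h x ∂(m t.toNNReal : Measure Opinion))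
      - ∫ x, h x ∂(m' t.toNNReal : Measure Opinion)) (K := 2) (l := 6) (δ := tvDist m₀ m₀')
    (by norm_num) (tvDist_nonneg _ _) ?_ ?_ t.2 hh hC hC₀
  · simpa using key
  · intro t h C _ _ hC _
    have a := abs_le.1 (abs_integral_le_of_abs_le hC (m t.toNNReal : Measure Opinion))
    have b := abs_le.1 (abs_integral_le_of_abs_le hC (m' t.toNNReal : Measure Opinion))
    rw [abs_le]
    constructor <;> linarith [a.1, a.2, b.1, b.2]
  · intro h C hh hC hC₀
    -- The linearized integrand is bounded by 4C + 2C, which is where the rate `6` comes from.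
    refine ⟨fun r x => generator w Δ (m r.toNNReal) h x
      + 2 * ∫ y, h (jump w Δ y x) ∂(m' r.toNNReal : Measure Opinion), fun r _ =>
        ⟨(measurable_generator hh hC _).add ((measurable_integral_jump_left hh _).const_mul 2),
        fun x => ?_⟩, ?_⟩
    · refine (abs_add_le _ _).trans ?_
      have a := abs_generator_le (w := w) (Δ := Δ) hh hC (m r.toNNReal) x
      have b : |∫ y, h (jump w Δ y x) ∂(m' r.toNNReal : Measure Opinion)| ≤ C :=
        abs_integral_le_of_abs_le (fun _ => hC _) _
      rw [abs_mul, abs_two]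
      linarith
    · intro t ht
      simp_rw [← integral_generator_sub hh hC]
      lift t to ℝ≥0 using ht
      have a := hm.2 h ⟨hh, C, hC⟩ t
      have b := hm'.2 h ⟨hh, C, hC⟩ t
      rw [intervalIntegral.integral_sub a.1 b.1, ← a.2, ← b.2, hm.1, hm'.1, Real.toNNReal_coe]
      refine le_trans (le_of_eq ?_) (abs_integral_sub_le_tvDist m₀ m₀' hh hC hC₀)
      congr 1
      ring

theorem IsSolution.tvDist_le_exp (hm : IsSolution w Δ m₀ m) (hm' : IsSolution w Δ m₀' m')
    (t : ℝ≥0) : tvDist (m t) (m' t) ≤ tvDist m₀ m₀' * Real.exp (6 * t) :=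
  Deffuant.tvDist_le fun φ hφ h1 => by
    simpa using (le_abs_self _).trans (hm.abs_integral_sub_le_exp hm' t hφ h1 zero_le_one)

theorem tvDist_self {S : Type*} [MeasurableSpace S] (μ : ProbabilityMeasure S) :
    tvDist μ μ = 0 :=
  le_antisymm (Deffuant.tvDist_le fun _ _ _ => by simp) (tvDist_nonneg _ _)

theorem IsSolution.unique (hm : IsSolution w Δ m₀ m) (hm' : IsSolution w Δ m₀ m') : m = m' := by
  funext t
  refine Subtype.ext (show (m t : Measure Opinion) = (m' t : Measure Opinion) from
    ext_of_integral fun h hh h1 => ?_)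
  have := hm.abs_integral_sub_le_exp hm' t hh h1 zero_le_one
  rw [tvDist_self, zero_mul, zero_mul] at this
  exact sub_eq_zero.1 (abs_nonpos_iff.1 this)

theorem IsSolution.exists_tvDist_lt (hm : IsSolution w Δ m₀ m) (T : ℝ≥0) {ε : ℝ} (hε : 0 < ε) :
    ∃ δ : ℝ, 0 < δ ∧ ∀ (m₀' : ProbabilityMeasure Opinion) (m' : ℝ≥0 → ProbabilityMeasure Opinion),
      IsSolution w Δ m₀' m' → tvDist m₀' m₀ < δ → ∀ t : ℝ≥0, t ≤ T → tvDist (m' t) (m t) < ε := by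
  refine ⟨ε / Real.exp (6 * T), by positivity, fun m₀' m' hm' hδ t ht => ?_⟩
  refine (hm'.tvDist_le_exp hm t).trans_lt ?_
  rw [lt_div_iff₀ (Real.exp_pos _)] at hδ
  refine lt_of_le_of_lt ?_ hδ
  refine mul_le_mul_of_nonneg_left (Real.exp_le_exp.2 ?_) (tvDist_nonneg _ _)
  have : (t : ℝ) ≤ T := ht
  linarith

end Solution

/-! ### Existence: the Wild sum -/

section Wild

/-- The law of the opinion after an encounter of independent peers with laws `μ` and `ν`. -/
def collision (w : Opinion) (Δ : ℝ) (μ ν : Measure Opinion) : Measure Opinion :=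
  (μ.prod ν).map fun p => jump w Δ p.1 p.2

instance (w : Opinion) (Δ : ℝ) (μ ν : Measure Opinion) [IsProbabilityMeasure μ]
    [IsProbabilityMeasure ν] : IsProbabilityMeasure (collision w Δ μ ν) :=
  Measure.isProbabilityMeasure_map (measurable_jump w Δ).aemeasurable

theorem integral_collision {w : Opinion} {Δ : ℝ} {μ ν : Measure Opinion} [IsProbabilityMeasure μ]
    [IsProbabilityMeasure ν] {h : Opinion → ℝ} (hh : IsBoundedMeasurable h) :
    ∫ x, h x ∂(collision w Δ μ ν) = ∫ x, ∫ y, h (jump w Δ x y) ∂ν ∂μ := by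
  have hb : IsBoundedMeasurable fun p : Opinion × Opinion => h (jump w Δ p.1 p.2) :=
    ⟨measurable_comp_jump hh.1, hh.2.imp fun C hC _ => hC _⟩
  rw [collision, integral_map (measurable_jump w Δ).aemeasurable
    hh.1.aestronglyMeasurable, integral_prod _ (hb.integrable _)]

variable (w : Opinion) (Δ : ℝ) (m₀ : ProbabilityMeasure Opinion)

/-- The terms of the Wild sum. -/
def wild : ℕ → Measure Opinion
  | 0 => m₀
  | n + 1 => ((n : ENNReal) + 1)⁻¹ • ∑ k : Fin (n + 1), collision w Δ (wild k) (wild (n - k))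
  decreasing_by all_goals omega

theorem isProbabilityMeasure_wild (n : ℕ) : IsProbabilityMeasure (wild w Δ m₀ n) := by
  induction n using Nat.strong_induction_on with
  | _ n ih =>
    cases n with
    | zero => rw [wild]; infer_instance
    | succ n =>
      rw [wild]
      constructor
      have h1 : ∀ k : Fin (n + 1),
          collision w Δ (wild w Δ m₀ k) (wild w Δ m₀ (n - k)) Set.univ = 1 := by
        intro k
        have := ih k (by omega)
        have := ih (n - k) (by omega)
        exact measure_univ
      rw [Measure.smul_apply, Measure.finsetSum_apply]
      simp only [h1, Finset.sum_const, Finset.card_univ, Fintype.card_fin, smul_eq_mul]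
      rw [nsmul_eq_mul, mul_one]
      push_cast
      exact ENNReal.inv_mul_cancel (by simp) (by finiteness)

instance (n : ℕ) : IsProbabilityMeasure (wild w Δ m₀ n) := isProbabilityMeasure_wild w Δ m₀ n

/-- This is the equation du/dτ = u∘u at order τⁿ: `n + 1` comes from differentiating τ^(n+1), and
the right side is a Cauchy product coefficient. -/
theorem integral_wild_succ {h : Opinion → ℝ} (hh : IsBoundedMeasurable h) (n : ℕ) :
    ((n : ℝ) + 1) * ∫ x, h x ∂(wild w Δ m₀ (n + 1)) =
      ∑ p ∈ Finset.HasAntidiagonal.antidiagonal n,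
        ∫ x, ∫ y, h (jump w Δ x y) ∂(wild w Δ m₀ p.2) ∂(wild w Δ m₀ p.1) := by
  rw [wild, integral_smul_measure, integral_finsetSum_measure fun i _ => hh.integrable _]
  simp_rw [integral_collision hh]
  rw [Finset.Nat.sum_antidiagonal_eq_sum_range_succ_mk, Finset.sum_range, ENNReal.toReal_inv,
    ENNReal.toReal_add (by finiteness) (by finiteness)]
  simp only [ENNReal.toReal_natCast, ENNReal.toReal_one, smul_eq_mul]
  rw [← mul_assoc, mul_inv_cancel₀ (by positivity), one_mul]

/-- The mixture of the terms of the Wild sum with geometric weights. -/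
def wildSum (τ : ℝ) : Measure Opinion :=
  Measure.sum fun n => ENNReal.ofReal ((1 - τ) * τ ^ n) • wild w Δ m₀ n

variable {τ : ℝ}

theorem isProbabilityMeasure_wildSum (h0 : 0 ≤ τ) (h1 : τ < 1) :
    IsProbabilityMeasure (wildSum w Δ m₀ τ) := by
  constructor
  have hs : HasSum (fun n => (1 - τ) * τ ^ n) 1 := by
    have := (hasSum_geometric_of_lt_one h0 h1).mul_left (1 - τ)
    rwa [mul_inv_cancel₀ (by linarith)] at this
  rw [wildSum, Measure.sum_apply _ MeasurableSet.univ]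
  simp only [Measure.smul_apply, measure_univ, smul_eq_mul, mul_one]
  rw [← ENNReal.ofReal_tsum_of_nonneg (fun n => mul_nonneg (by linarith) (by positivity))
    hs.summable, hs.tsum_eq, ENNReal.ofReal_one]

theorem hasSum_integral_wildSum (h0 : 0 ≤ τ) (h1 : τ < 1) {h : Opinion → ℝ}
    (hh : IsBoundedMeasurable h) :
    HasSum (fun n => (1 - τ) * τ ^ n * ∫ x, h x ∂(wild w Δ m₀ n))
      (∫ x, h x ∂(wildSum w Δ m₀ τ)) := by
  have := isProbabilityMeasure_wildSum w Δ m₀ h0 h1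
  have key := hasSum_integral_measure (hh.integrable (wildSum w Δ m₀ τ))
  have hn : ∀ n : ℕ, 0 ≤ (1 - τ) * τ ^ n := fun n => mul_nonneg (by linarith) (by positivity)
  simp_rw [integral_smul_measure, ENNReal.toReal_ofReal (hn _), smul_eq_mul] at key
  exact key

/-- Expanding both measures gives a double series in τ^(k+l), absolutely convergent as the integrals
are bounded. Grouping by n = k + l and applying `integral_wild_succ` produces (1 - τ)² times the
derivative of ∑ τⁿ ∫ h dW_n. -/
theorem integral_integral_wildSum (h0 : 0 ≤ τ) (h1 : τ < 1) {h : Opinion → ℝ}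
    (hh : IsBoundedMeasurable h) :
    ∫ x, ∫ y, h (jump w Δ x y) ∂(wildSum w Δ m₀ τ) ∂(wildSum w Δ m₀ τ) =
      (1 - τ) ^ 2 * ∑' n : ℕ, τ ^ n * (((n : ℝ) + 1) * ∫ x, h x ∂(wild w Δ m₀ (n + 1))) := by
  have hP := isProbabilityMeasure_wildSum w Δ m₀ h0 h1
  obtain ⟨hm, C, hC⟩ := hh
  have hb : ∀ μ : Measure Opinion, [IsProbabilityMeasure μ] →
      IsBoundedMeasurable (fun x => ∫ y, h (jump w Δ x y) ∂μ) := fun μ _ =>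
    ⟨(measurable_comp_jump hm).stronglyMeasurable.integral_prod_right.measurable, C, fun x =>
      abs_integral_le_of_abs_le (fun _ => hC _) _⟩
  have hb' : ∀ μ : Measure Opinion, [IsProbabilityMeasure μ] →
      IsBoundedMeasurable (fun y => ∫ x, h (jump w Δ x y) ∂μ) := fun μ _ =>
    ⟨(measurable_comp_jump hm).stronglyMeasurable.integral_prod_left.measurable, C, fun x =>
      abs_integral_le_of_abs_le (fun _ => hC _) _⟩
  have hswap : ∀ μ ν : Measure Opinion, [IsProbabilityMeasure μ] → [IsProbabilityMeasure ν] →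
      ∫ x, ∫ y, h (jump w Δ x y) ∂ν ∂μ = ∫ y, ∫ x, h (jump w Δ x y) ∂μ ∂ν := by
    intro μ ν _ _
    exact integral_integral_swap (f := fun x y => h (jump w Δ x y))
      (IsBoundedMeasurable.integrable ⟨measurable_comp_jump hm, C, fun _ => hC _⟩ _)
  set b : ℕ → ℕ → ℝ := fun k l =>
    ∫ x, ∫ y, h (jump w Δ x y) ∂(wild w Δ m₀ l) ∂(wild w Δ m₀ k) with hbdef
  have hbC : ∀ k l, |b k l| ≤ C := fun k l =>
    abs_integral_le_of_abs_le (fun x => abs_integral_le_of_abs_le (fun _ => hC _) _) _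
  have e1 := (hasSum_integral_wildSum w Δ m₀ h0 h1 (hb (wildSum w Δ m₀ τ))).tsum_eq
  have e2 : ∀ k, ∫ x, ∫ y, h (jump w Δ x y) ∂(wildSum w Δ m₀ τ) ∂(wild w Δ m₀ k) =
      (1 - τ) * ∑' l, τ ^ l * b k l := by
    intro k
    rw [hswap, ← (hasSum_integral_wildSum w Δ m₀ h0 h1 (hb' (wild w Δ m₀ k))).tsum_eq,
      ← tsum_mul_left]
    refine tsum_congr fun l => ?_
    simp only [hbdef]
    rw [hswap]
    ring
  rw [← e1]
  simp_rw [e2]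
  have hsum : Summable fun p : ℕ × ℕ => τ ^ p.1 * τ ^ p.2 * b p.1 p.2 := by
    have hg := summable_geometric_of_lt_one h0 h1
    have h2 : Summable fun p : ℕ × ℕ => τ ^ p.1 * τ ^ p.2 :=
      hg.mul_of_nonneg hg (fun _ => by positivity) (fun _ => by positivity)
    refine Summable.of_norm_bounded (h2.mul_right C) fun p => ?_
    rw [norm_mul, Real.norm_of_nonneg (by positivity : (0 : ℝ) ≤ τ ^ p.1 * τ ^ p.2)]
    exact mul_le_mul_of_nonneg_left (hbC _ _) (by positivity)
  have e3 : ∀ k, (1 - τ) * τ ^ k * ((1 - τ) * ∑' l, τ ^ l * b k l) =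
      (1 - τ) ^ 2 * ∑' l, τ ^ k * τ ^ l * b k l := by
    intro k
    simp_rw [mul_assoc (τ ^ k)]
    rw [tsum_mul_left]
    ring
  simp_rw [e3]
  rw [tsum_mul_left, ← hsum.tsum_prod (f := fun p : ℕ × ℕ => τ ^ p.1 * τ ^ p.2 * b p.1 p.2),
    ← Finset.HasAntidiagonal.sigmaAntidiagonalEquivProd.tsum_eq
      (fun p : ℕ × ℕ => τ ^ p.1 * τ ^ p.2 * b p.1 p.2)]
  congr 1
  refine (((Finset.HasAntidiagonal.sigmaAntidiagonalEquivProd.summable_iff).2 hsum).tsum_sigma'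
    (fun n => (hasSum_fintype _).summable)).trans ?_
  refine tsum_congr fun n => ?_
  rw [integral_wild_succ w Δ m₀ ⟨hm, C, hC⟩, tsum_fintype, Finset.mul_sum]
  refine Eq.trans ?_ (Finset.sum_coe_sort (Finset.HasAntidiagonal.antidiagonal n)
    fun p => τ ^ n * b p.1 p.2)
  refine Finset.sum_congr rfl fun p _ => ?_
  have hp : (p : ℕ × ℕ).1 + (p : ℕ × ℕ).2 = n := Finset.HasAntidiagonal.mem_antidiagonal.1 p.2
  simp only [Function.comp, Finset.HasAntidiagonal.sigmaAntidiagonalEquivProd_apply, hbdef]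
  rw [← pow_add, hp]

/-- Termwise differentiation on (-r, r) with |τ| < r < 1. Negative τ are admitted because a
two-sided derivative is taken at time 0, where τ = 0. -/
theorem hasDerivAt_tsum_pow {q : ℕ → ℝ} {C : ℝ} (hq : ∀ n, |q n| ≤ C) {τ : ℝ} (h1 : |τ| < 1) :
    HasDerivAt (fun τ => ∑' n, τ ^ n * q n)
      (∑' n : ℕ, τ ^ n * (((n : ℝ) + 1) * q (n + 1))) τ := by
  obtain ⟨r, hr, hr1⟩ := exists_between h1
  have hr0 : 0 ≤ r := (abs_nonneg _).trans hr.le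
  have hC0 : 0 ≤ C := (abs_nonneg _).trans (hq 0)
  have hu : Summable fun n : ℕ => (n : ℝ) * r ^ (n - 1) * C := by
    refine Summable.mul_right C ?_
    refine (summable_nat_add_iff 1).1 ?_
    have a := summable_pow_mul_geometric_of_norm_lt_one 1
      (by rwa [Real.norm_of_nonneg hr0] : ‖r‖ < 1)
    have b := summable_geometric_of_lt_one hr0 hr1
    refine (a.add b).congr fun n => ?_
    push_cast
    simp
    ring
  have hbd : ∀ (n : ℕ) (y : ℝ), y ∈ Set.Ioo (-r) r →
      ‖(n : ℝ) * y ^ (n - 1) * q n‖ ≤ (n : ℝ) * r ^ (n - 1) * C := by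
    intro n y hy
    have hy' : |y| ≤ r := abs_le.2 ⟨hy.1.le, hy.2.le⟩
    rw [norm_mul, norm_mul, norm_pow, Real.norm_natCast, Real.norm_eq_abs, Real.norm_eq_abs]
    gcongr
    exact hq n
  have hmem : τ ∈ Set.Ioo (-r) r := ⟨(abs_lt.1 hr).1, (abs_lt.1 hr).2⟩
  have key := hasDerivAt_tsum_of_isPreconnected hu isOpen_Ioo
    isPreconnected_Ioo (g := fun n y => y ^ n * q n) (g' := fun n y => (n : ℝ) * y ^ (n - 1) * q n)
    (fun n y _ => (hasDerivAt_pow n y).mul_const _) hbd hmem ?_ hmem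
  · refine key.congr_deriv ?_
    have hs : Summable fun n : ℕ => (n : ℝ) * τ ^ (n - 1) * q n :=
      Summable.of_norm_bounded hu fun n => hbd n τ hmem
    -- The truncated exponent `0 - 1` is harmless: the term carries the factor `0`.
    have e0 : ((0 : ℕ) : ℝ) * τ ^ (0 - 1) * q 0 = 0 := by simp
    refine hs.tsum_eq_zero_add.trans ((congrArg₂ (· + ·) e0 (tsum_congr fun n => ?_)).trans
      (zero_add _))
    rw [Nat.add_sub_cancel]
    push_cast
    ring
  · refine Summable.of_norm_bounded ((summable_geometric_of_lt_one (abs_nonneg _) h1).mul_right C)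
      fun n => ?_
    rw [norm_mul, norm_pow, Real.norm_eq_abs, Real.norm_eq_abs]
    gcongr
    exact hq n

/-- The solution to Problem 1, given by its Wild sum. -/
def wildSolution (t : ℝ≥0) : ProbabilityMeasure Opinion :=
  ⟨wildSum w Δ m₀ (1 - Real.exp (-2 * t)), isProbabilityMeasure_wildSum w Δ m₀
    (by simp) (by simp [Real.exp_pos])⟩

theorem coe_wildSolution (t : ℝ≥0) :
    (wildSolution w Δ m₀ t : Measure Opinion) = wildSum w Δ m₀ (1 - Real.exp (-2 * t)) := rfl

theorem wildSum_zero : wildSum w Δ m₀ 0 = m₀ := by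
  have := isProbabilityMeasure_wildSum w Δ m₀ le_rfl zero_lt_one
  refine ext_of_integral fun h hh h1 => ?_
  refine (hasSum_integral_wildSum w Δ m₀ le_rfl zero_lt_one ⟨hh, 1, h1⟩).unique ?_
  convert hasSum_single (f := fun n => (1 - 0) * 0 ^ n * ∫ x, h x ∂(wild w Δ m₀ n)) 0 ?_ using 1
  · simp [wild]
  · intro n hn
    simp [hn]

/-- With u(τ) = ∑ τⁿ q n, the integral of `h` at time s is F(s) = e^{-2s} u(1 - e^{-2s}). Hence F' =
-2F + 2 e^{-4s} u'(τ), and e^{-4s} u'(τ) = (1 - τ)² u'(τ) is the collision term by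
`integral_integral_wildSum`. -/
theorem isSolution_wildSolution : IsSolution w Δ m₀ (wildSolution w Δ m₀) := by
  refine ⟨Subtype.ext ?_, fun h hh t => ?_⟩
  · show wildSum w Δ m₀ (1 - Real.exp (-2 * ((0 : ℝ≥0) : ℝ))) = m₀
    simp [wildSum_zero]
  obtain ⟨hm, C, hC⟩ := hh
  set q : ℕ → ℝ := fun n => ∫ x, h x ∂(wild w Δ m₀ n) with hqdef
  have hq : ∀ n, |q n| ≤ C := fun n => abs_integral_le_of_abs_le hC _
  set F : ℝ → ℝ := fun s => Real.exp (-2 * s) * ∑' n, (1 - Real.exp (-2 * s)) ^ n * q n with hF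
  have hFm : ∀ s : ℝ≥0, ∫ x, h x ∂(wildSolution w Δ m₀ s : Measure Opinion) = F s := by
    intro s
    rw [coe_wildSolution, hF, ← (hasSum_integral_wildSum w Δ m₀ (τ := 1 - Real.exp (-2 * s))
      (by simp) (by simp [Real.exp_pos]) ⟨hm, C, hC⟩).tsum_eq]
    simp_rw [mul_assoc]
    rw [tsum_mul_left]
    simp [hqdef]
  set G : ℝ → ℝ := fun s => ∫ x, generator w Δ (wildSolution w Δ m₀ s.toNNReal) h x
    ∂(wildSolution w Δ m₀ s.toNNReal : Measure Opinion) with hG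
  have hderiv : ∀ s : ℝ, 0 ≤ s → HasDerivAt F (G s) s := by
    intro s hs
    have hτ0 : 0 ≤ 1 - Real.exp (-2 * s) := by simpa using hs
    have hτ1 : 1 - Real.exp (-2 * s) < 1 := by simp [Real.exp_pos]
    have hE : HasDerivAt (fun s : ℝ => Real.exp (-2 * s)) (Real.exp (-2 * s) * -2) s := by
      simpa using ((hasDerivAt_id s).const_mul (-2)).exp
    have h1 := (hasDerivAt_tsum_pow hq (abs_lt.2 ⟨by linarith, hτ1⟩)).comp s (hE.const_sub 1)
    have h2 := hE.mul h1
    refine h2.congr_deriv ?_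
    have hGs : G s = 2 * ((∫ x, ∫ y, h (jump w Δ x y)
        ∂(wildSolution w Δ m₀ s.toNNReal : Measure Opinion)
        ∂(wildSolution w Δ m₀ s.toNNReal : Measure Opinion))
        - ∫ x, h x ∂(wildSolution w Δ m₀ s.toNNReal : Measure Opinion)) := by
      simp_rw [hG, generator_eq hm hC]
      rw [integral_const_mul, integral_sub
        (IsBoundedMeasurable.integrable
          ⟨(measurable_comp_jump hm).stronglyMeasurable.integral_prod_right.measurable, C, fun x =>
            abs_integral_le_of_abs_le (fun _ => hC _) _⟩ _)
        (IsBoundedMeasurable.integrable ⟨hm, C, hC⟩ _)]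
    rw [hGs, hFm, coe_wildSolution, Real.coe_toNNReal s hs,
      integral_integral_wildSum w Δ m₀ hτ0 hτ1 ⟨hm, C, hC⟩]
    simp only [hF, Function.comp, hqdef]
    ring
  have hint : IntervalIntegrable G volume 0 t := by
    rw [intervalIntegrable_iff]
    refine IntegrableOn.of_bound (by simp) ?_ (4 * C) (Eventually.of_forall fun s =>
      abs_integral_generator_le w Δ hm hC _ _)
    -- Measurability of `G` in time comes for free, since on the interval it is the derivative of
    -- `F`.
    refine (measurable_deriv F).aestronglyMeasurable.congr ?_
    refine (ae_restrict_iff' measurableSet_uIoc).2 (Eventually.of_forall fun s hs => ?_)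
    rw [Set.uIoc_of_le t.coe_nonneg] at hs
    exact (hderiv s hs.1.le).deriv
  refine ⟨hint, ?_⟩
  rw [hFm, hFm, intervalIntegral.integral_eq_sub_of_hasDerivAt (f := F) (fun s hs => ?_) hint]
  · simp
  · rw [Set.uIcc_of_le t.coe_nonneg] at hs
    exact hderiv s hs.1

end Wild

/-! ### Joint and progressive measurability of right-continuous paths -/

section PathMeasurability

variable {Ω : Type*} [MeasurableSpace Ω] {X : ℝ≥0 → Ω → Opinion}

/-- The path is sampled on finer and finer grids, at points to the right of the given time. Cutting
times at `t` leaves only coordinates up to `t`, so this is progressive measurability. -/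
theorem measurable_uncurry_min (t : ℝ≥0) (hX : ∀ u ≤ t, Measurable (X u))
    (hr : ∀ ω u, ContinuousWithinAt (fun v => X v ω) (Set.Ici u) u) :
    Measurable fun p : ℝ≥0 × Ω => X (min p.1 t) p.2 := by
  -- The numerator is `k + 1`, not `k`, so that the grid point attached to a time lies to its right,
  -- where the path is continuous.
  obtain ⟨d, hd⟩ : ∃ d : ℕ → ℕ → ℝ≥0, ∀ n k, d n k = ((k : ℝ≥0) + 1) / ((n : ℝ≥0) + 1) :=
    ⟨_, fun _ _ => rfl⟩
  have hmeas : ∀ n : ℕ, Measurable fun p : ℝ≥0 × Ω =>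
      X (min (d n ⌊p.1 * ((n : ℝ≥0) + 1)⌋₊) t) p.2 := by
    intro n
    have h1 : Measurable fun q : Ω × ℕ => X (min (d n q.2) t) q.1 :=
      measurable_from_prod_countable_left fun k =>
        show Measurable (X (min (d n k) t)) from hX _ (min_le_right _ _)
    have h2 : Measurable fun p : ℝ≥0 × Ω => (p.2, ⌊p.1 * ((n : ℝ≥0) + 1)⌋₊) :=
      measurable_snd.prodMk (Nat.measurable_floor.comp (measurable_fst.mul_const _))
    exact h1.comp h2
  refine measurable_of_tendsto_metrizable hmeas (tendsto_pi_nhds.2 ?_)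
  rintro ⟨s, ω⟩
  refine (hr ω (min s t)).tendsto.comp (tendsto_nhdsWithin_iff.2 ⟨?_, Eventually.of_forall ?_⟩)
  · refine Tendsto.min ?_ tendsto_const_nhds
    have hlo : ∀ n : ℕ, s ≤ d n ⌊s * ((n : ℝ≥0) + 1)⌋₊ := fun n => by
      rw [hd, le_div_iff₀ (by positivity)]
      exact (Nat.lt_floor_add_one _).le
    have hup : ∀ n : ℕ, d n ⌊s * ((n : ℝ≥0) + 1)⌋₊ ≤ s + 1 / ((n : ℝ≥0) + 1) := fun n => by
      rw [hd]
      have hpos : (0 : ℝ≥0) < (n : ℝ≥0) + 1 := by positivity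
      rw [div_le_iff₀ hpos, add_mul, one_div, inv_mul_cancel₀ hpos.ne']
      gcongr
      exact Nat.floor_le (by positivity)
    refine tendsto_of_tendsto_of_tendsto_of_le_of_le tendsto_const_nhds ?_ hlo hup
    simpa using (tendsto_const_nhds (x := s)).add
      (tendsto_one_div_add_atTop_nhds_zero_nat (𝕜 := ℝ≥0))
  · intro n
    refine min_le_min_right t ?_
    rw [hd, le_div_iff₀ (by positivity)]
    exact (Nat.lt_floor_add_one _).le

theorem measurable_uncurry_of_rightContinuous (hX : ∀ u, Measurable (X u))
    (hr : ∀ ω u, ContinuousWithinAt (fun v => X v ω) (Set.Ici u) u) :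
    Measurable fun p : ℝ≥0 × Ω => X p.1 p.2 := by
  refine measurable_of_tendsto_metrizable
    (fun n : ℕ => measurable_uncurry_min (n : ℝ≥0) (fun u _ => hX u) hr) (tendsto_pi_nhds.2 ?_)
  rintro ⟨s, ω⟩
  obtain ⟨N, hN⟩ := exists_nat_ge s
  refine tendsto_const_nhds.congr' ?_
  filter_upwards [eventually_ge_atTop N] with n hn
  have : s ≤ (n : ℝ≥0) := hN.trans (by exact_mod_cast hn)
  simp [this]

/-- Used with `canonicalFiltration t` as the σ-field, where it says that the integral term of the
Dynkin process is adapted. -/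
theorem measurable_integral_path (t : ℝ≥0) (hX : ∀ u ≤ t, Measurable (X u))
    (hr : ∀ ω u, ContinuousWithinAt (fun v => X v ω) (Set.Ici u) u) {a : ℝ × Opinion → ℝ}
    (ha : Measurable a) :
    Measurable fun ω => ∫ s in (0 : ℝ)..t, a (s, X s.toNNReal ω) := by
  have e : ∀ ω, ∫ s in (0 : ℝ)..t, a (s, X s.toNNReal ω) =
      ∫ s in Set.Ioc (0 : ℝ) t, a (s, X (min s.toNNReal t) ω) := by
    intro ω
    rw [intervalIntegral.integral_of_le t.coe_nonneg]
    refine setIntegral_congr_fun measurableSet_Ioc fun s hs => ?_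
    have : s.toNNReal ≤ t := Real.toNNReal_le_iff_le_coe.2 hs.2
    simp [this]
  simp_rw [e]
  have hm : Measurable fun p : Ω × ℝ => a (p.2, X (min p.2.toNNReal t) p.1) :=
    ha.comp (measurable_snd.prodMk ((measurable_uncurry_min t hX hr).comp
      ((measurable_real_toNNReal.comp measurable_snd).prodMk measurable_fst)))
  exact hm.stronglyMeasurable.integral_prod_right.measurable

end PathMeasurability

/-! ### Linear flows with bounded generators -/

section Rate

/-- A family of operators that is bounded, uniformly in time, on bounded measurable functions and
that depends measurably on time. -/
def HasBoundedRate (A : ℝ≥0 → (Opinion → ℝ) → Opinion → ℝ) (l : ℝ) : Prop :=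
  0 ≤ l ∧ ∀ (h : Opinion → ℝ) (C : ℝ), Measurable h → (∀ x, |h x| ≤ C) →
    (Measurable fun p : ℝ × Opinion => A p.1.toNNReal h p.2) ∧ ∀ s x, |A s h x| ≤ l * C

theorem HasBoundedRate.measurable {A : ℝ≥0 → (Opinion → ℝ) → Opinion → ℝ} {l : ℝ}
    (hA : HasBoundedRate A l) {h : Opinion → ℝ} (hh : IsBoundedMeasurable h) (s : ℝ≥0) :
    Measurable (A s h) := by
  obtain ⟨hm, C, hC⟩ := hh
  have := (hA.2 h C hm hC).1.comp (measurable_prodMk_left (x := (s : ℝ)))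
  simpa [Function.comp_def] using this

/-- The mass of each measurable set is Lipschitz in time. -/
theorem IsSolution.measurable {w : Opinion} {Δ : ℝ} {m₀ : ProbabilityMeasure Opinion}
    {m : ℝ≥0 → ProbabilityMeasure Opinion} (hm : IsSolution w Δ m₀ m) :
    Measurable fun t => (m t : Measure Opinion) := by
  refine Measure.measurable_of_measurable_coe _ fun s hs => ?_
  have hb : ∀ x, |s.indicator (1 : Opinion → ℝ) x| ≤ 1 := fun x => by
    by_cases hx : x ∈ s <;> simp [hx]
  have hc : Continuous fun t => (m t : Measure Opinion).real s := by
    refine (LipschitzWith.of_dist_le_mul (K := 4) fun u v => ?_).continuous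
    have := hm.abs_integral_sub_le (measurable_one.indicator hs) hb u v
    rw [integral_indicator_one hs, integral_indicator_one hs] at this
    simpa [Real.dist_eq, NNReal.dist_eq] using this
  simpa [Measure.real] using hc.measurable.ennreal_ofReal

theorem IsSolution.hasBoundedRate {w : Opinion} {Δ : ℝ} {m₀ : ProbabilityMeasure Opinion}
    {m : ℝ≥0 → ProbabilityMeasure Opinion} (hm : IsSolution w Δ m₀ m) :
    HasBoundedRate (fun t => generator w Δ (m t)) 4 := by
  refine ⟨by norm_num, fun h C hh hC => ⟨?_, fun s x => abs_generator_le hh hC _ x⟩⟩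
  let κ : Kernel (ℝ × Opinion) Opinion :=
    ⟨fun p => (m p.1.toNNReal : Measure Opinion),
      hm.measurable.comp (measurable_real_toNNReal.comp measurable_fst)⟩
  have : IsMarkovKernel κ := ⟨fun p => (inferInstance :
    IsProbabilityMeasure (m p.1.toNNReal : Measure Opinion))⟩
  simp_rw [generator_eq hh hC]
  have h1 : StronglyMeasurable fun q : (ℝ × Opinion) × Opinion => h (jump w Δ q.1.2 q.2) :=
    ((measurable_comp_jump hh).comp
      ((measurable_snd.comp measurable_fst).prodMk measurable_snd)).stronglyMeasurable
  have h2 := (StronglyMeasurable.integral_kernel_prod_right' (κ := κ) h1).measurable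
  exact (h2.sub (hh.comp measurable_snd)).const_mul 2

/-- `ν` is a family of functionals, bounded on bounded measurable functions, that solves
`d/dt ν t h = ν t (A t h)`. -/
structure IsLinearFlow (A : ℝ≥0 → (Opinion → ℝ) → Opinion → ℝ)
    (ν : ℝ → (Opinion → ℝ) → ℝ) : Prop where
  bound : ∃ K : ℝ, ∀ t h C, 0 ≤ t → Measurable h → (∀ x, |h x| ≤ C) → 0 ≤ C → |ν t h| ≤ K * C
  integrable : ∀ h, IsBoundedMeasurable h → ∀ t, 0 ≤ t →
    IntervalIntegrable (fun r => ν r (A r.toNNReal h)) volume 0 t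
  eq : ∀ h, IsBoundedMeasurable h → ∀ t, 0 ≤ t →
    ν t h - ν 0 h = ∫ r in (0 : ℝ)..t, ν r (A r.toNNReal h)

/-- The difference of the two flows satisfies `gronwall_functional` with error `δ = 0` and `g r = A
r h`. -/
theorem IsLinearFlow.unique {A : ℝ≥0 → (Opinion → ℝ) → Opinion → ℝ} {l : ℝ}
    (hA : HasBoundedRate A l) {ν ν' : ℝ → (Opinion → ℝ) → ℝ} (hν : IsLinearFlow A ν)
    (hν' : IsLinearFlow A ν') (h0 : ∀ h, IsBoundedMeasurable h → ν 0 h = ν' 0 h) {t : ℝ}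
    (ht : 0 ≤ t) {h : Opinion → ℝ} (hh : IsBoundedMeasurable h) : ν t h = ν' t h := by
  obtain ⟨K, hK⟩ := hν.bound
  obtain ⟨K', hK'⟩ := hν'.bound
  obtain ⟨hm, C, hC⟩ := hh
  have hC₀ : 0 ≤ C := (abs_nonneg _).trans (hC 0)
  have key := gronwall_functional (S := Opinion) (L := fun t h => ν t h - ν' t h) (K := K + K')
    (l := l) (δ := 0) hA.1 le_rfl ?_ ?_ ht hm hC hC₀
  · rw [zero_mul, zero_mul] at key
    exact sub_eq_zero.1 (abs_nonpos_iff.1 key)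
  · intro t h C ht hm hC hC₀
    have a := abs_le.1 (hK t h C ht hm hC hC₀)
    have b := abs_le.1 (hK' t h C ht hm hC hC₀)
    rw [abs_le]
    constructor <;> nlinarith [a.1, a.2, b.1, b.2]
  · intro h C hm hC hC₀
    refine ⟨fun r => A r.toNNReal h, fun r _ => ⟨hA.measurable ⟨hm, C, hC⟩ _,
      (hA.2 h C hm hC).2 _⟩, fun t ht => ?_⟩
    have hh : IsBoundedMeasurable h := ⟨hm, C, hC⟩
    rw [intervalIntegral.integral_sub (hν.integrable h hh t ht) (hν'.integrable h hh t ht),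
      ← hν.eq h hh t ht, ← hν'.eq h hh t ht, h0 h hh]
    simp

/-- Once `m` is frozen in the generator, the nonlinear equation says that `m` solves a linear one.
The marginals of a Markov law solve the same equation. -/
theorem IsSolution.isLinearFlow {w : Opinion} {Δ : ℝ} {m₀ : ProbabilityMeasure Opinion}
    {m : ℝ≥0 → ProbabilityMeasure Opinion} (hm : IsSolution w Δ m₀ m) :
    IsLinearFlow (fun t => generator w Δ (m t))
      (fun t h => ∫ x, h x ∂(m t.toNNReal : Measure Opinion)) where
  bound := ⟨1, fun t h C _ _ hC _ => by simpa using abs_integral_le_of_abs_le hC _⟩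
  integrable h hh t ht := by
    lift t to ℝ≥0 using ht
    exact (hm.2 h hh t).1
  eq h hh t ht := by
    lift t to ℝ≥0 using ht
    simpa using (hm.2 h hh t).2

end Rate

/-! ### From the martingale problem to linear flows -/

section MartingaleProblem

theorem rightContinuous_coord (x : SkorokhodSpace Opinion) (u : ℝ≥0) :
    ContinuousWithinAt (fun v => coord v x) (Set.Ici u) u := (x.2 u).1

theorem measurable_coord_uncurry :
    Measurable fun p : ℝ≥0 × SkorokhodSpace Opinion => coord p.1 p.2 :=
  measurable_uncurry_of_rightContinuous measurable_coord rightContinuous_coord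

theorem measurable_coord_canonicalFiltration {s t : ℝ≥0} (h : s ≤ t) :
    Measurable[canonicalFiltration t] (coord s) :=
  ((Filtration.stronglyAdapted_natural fun t =>
    (measurable_coord t).stronglyMeasurable).stronglyMeasurable_le h).measurable

variable {A : ℝ≥0 → (Opinion → ℝ) → Opinion → ℝ} {l : ℝ}

/-- The process whose martingale property is required of a Markov law with generator `A`. -/
def dynkin (A : ℝ≥0 → (Opinion → ℝ) → Opinion → ℝ) (h : Opinion → ℝ) (t : ℝ≥0)
    (x : SkorokhodSpace Opinion) : ℝ :=
  h (coord t x) - h (coord 0 x) - ∫ s in (0 : ℝ)..t, A s.toNNReal h (coord s.toNNReal x)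

theorem intervalIntegrable_path (hA : HasBoundedRate A l) {h : Opinion → ℝ}
    (hh : IsBoundedMeasurable h) (x : SkorokhodSpace Opinion) (s t : ℝ) :
    IntervalIntegrable (fun s => A s.toNNReal h (coord s.toNNReal x)) volume s t := by
  obtain ⟨hm, C, hC⟩ := hh
  rw [intervalIntegrable_iff]
  refine IntegrableOn.of_bound (by simp) ?_ (l * C) (Eventually.of_forall fun s =>
    (hA.2 h C hm hC).2 _ _)
  refine Measurable.aestronglyMeasurable ?_
  exact (hA.2 h C hm hC).1.comp (measurable_id.prodMk (measurable_coord_uncurry.comp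
    (measurable_real_toNNReal.prodMk measurable_const)))

theorem measurable_dynkin (hA : HasBoundedRate A l) {h : Opinion → ℝ}
    (hh : IsBoundedMeasurable h) (t : ℝ≥0) :
    Measurable[canonicalFiltration t] (dynkin A h t) := by
  obtain ⟨hm, C, hC⟩ := hh
  refine Measurable.sub (Measurable.sub ?_ ?_) ?_
  · exact hm.comp (measurable_coord_canonicalFiltration le_rfl)
  · exact hm.comp (measurable_coord_canonicalFiltration zero_le)
  · exact @measurable_integral_path _ (canonicalFiltration t) _ t
      (fun u hu => measurable_coord_canonicalFiltration hu) rightContinuous_coord _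
      (hA.2 h C hm hC).1

theorem dynkin_sub (hA : HasBoundedRate A l) {h : Opinion → ℝ} (hh : IsBoundedMeasurable h)
    (s t : ℝ≥0) (x : SkorokhodSpace Opinion) :
    dynkin A h t x - dynkin A h s x = h (coord t x) - h (coord s x)
      - ∫ r in (s : ℝ)..t, A r.toNNReal h (coord r.toNNReal x) := by
  rw [← intervalIntegral.integral_interval_sub_left (intervalIntegrable_path hA hh x 0 t)
    (intervalIntegrable_path hA hh x 0 s)]
  simp only [dynkin]
  ring

/-- A factor known at time `s` leaves the conditional expectation of the increment, which vanishes.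
The bound on `ξ` is only almost sure because `ξ` will also be a conditional expectation. -/
theorem integral_mul_martingale_sub {Ω : Type*} {m0 : MeasurableSpace Ω} {ℱ : Filtration ℝ≥0 m0}
    {P : Measure Ω} [IsFiniteMeasure P] {M : ℝ≥0 → Ω → ℝ} (hM : Martingale M ℱ P) {s t : ℝ≥0}
    (hst : s ≤ t) {ξ : Ω → ℝ} (hξ : Measurable[ℱ s] ξ) {K : ℝ} (hK : ∀ᵐ x ∂P, |ξ x| ≤ K) :
    ∫ x, ξ x * (M t x - M s x) ∂P = 0 := by
  have hi : Integrable (M t - M s) P := (hM.integrable t).sub (hM.integrable s)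
  have h1 : P[ξ * (M t - M s) | ℱ s] =ᵐ[P] ξ * P[M t - M s | ℱ s] :=
    condExp_stronglyMeasurable_mul_of_bound (ℱ.le s) hξ.stronglyMeasurable hi K hK
  have h2 : P[M t - M s | ℱ s] =ᵐ[P] 0 := by
    have a := condExp_sub (hM.integrable t) (hM.integrable s) (ℱ s)
    have b := hM.condExp_ae_eq hst
    have c := hM.condExp_ae_eq (le_refl s)
    filter_upwards [a, b, c] with x ha hb hc
    rw [ha, Pi.sub_apply, hb, hc, sub_self]
    rfl
  have h3 : ∫ x, ξ x * (M t x - M s x) ∂P = ∫ x, (P[ξ * (M t - M s) | ℱ s]) x ∂P :=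
    (integral_condExp (ℱ.le s)).symm
  rw [h3]
  have h4 : P[ξ * (M t - M s) | ℱ s] =ᵐ[P] 0 := by
    filter_upwards [h1, h2] with x h1 h2
    rw [h1, Pi.mul_apply, h2]
    simp
  rw [integral_congr_ae h4]
  simp

variable {Q Q' : ProbabilityMeasure (SkorokhodSpace Opinion)}

/-- The Dynkin increment after time `s`, multiplied by `ξ`, has mean zero; Fubini moves the
expectation inside the time integral. Every use of the martingale problem goes through a choice of
`ξ`. -/
theorem isLinearFlow_weighted (hA : HasBoundedRate A l)
    (hQ : ∀ h, IsBoundedMeasurable h →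
      Martingale (dynkin A h) canonicalFiltration (Q : Measure (SkorokhodSpace Opinion)))
    {s : ℝ≥0} {ξ : SkorokhodSpace Opinion → ℝ} (hξ : Measurable[canonicalFiltration s] ξ) {K : ℝ}
    (hK : ∀ᵐ x ∂(Q : Measure (SkorokhodSpace Opinion)), |ξ x| ≤ K) :
    IsLinearFlow (fun r => A (s + r)) (fun r h =>
      ∫ x, ξ x * h (coord (s + r.toNNReal) x) ∂(Q : Measure (SkorokhodSpace Opinion))) := by
  have hξm : Measurable ξ := hξ.mono (canonicalFiltration.le s) le_rfl
  have hK₀ : 0 ≤ K := by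
    obtain ⟨x, hx⟩ := hK.exists
    exact (abs_nonneg _).trans hx
  have hb : ∀ g : SkorokhodSpace Opinion → ℝ, ∀ C, (∀ x, |g x| ≤ C) →
      ∀ᵐ x ∂(Q : Measure (SkorokhodSpace Opinion)), ‖ξ x * g x‖ ≤ K * C := by
    intro g C hC
    filter_upwards [hK] with x hx
    rw [norm_mul]
    exact mul_le_mul hx (hC x) (norm_nonneg _) hK₀
  have hjoint : ∀ h, IsBoundedMeasurable h → Measurable fun p : ℝ × SkorokhodSpace Opinion =>
      ξ p.2 * A p.1.toNNReal h (coord p.1.toNNReal p.2) := by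
    rintro h ⟨hm, C, hC⟩
    refine (hξm.comp measurable_snd).mul ((hA.2 h C hm hC).1.comp (measurable_fst.prodMk ?_))
    exact measurable_coord_uncurry.comp
      ((measurable_real_toNNReal.comp measurable_fst).prodMk measurable_snd)
  have hint : ∀ h, IsBoundedMeasurable h → ∀ u v : ℝ, IntervalIntegrable (fun r : ℝ => ∫ x, ξ x
      * A r.toNNReal h (coord r.toNNReal x) ∂(Q : Measure (SkorokhodSpace Opinion)))
      volume u v := by
    intro h hh u v
    obtain ⟨hm, C, hC⟩ := hh
    rw [intervalIntegrable_iff]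
    refine IntegrableOn.of_bound (by simp) ?_ (K * (l * C)) (Eventually.of_forall fun r => ?_)
    · exact (hjoint h ⟨hm, C, hC⟩).stronglyMeasurable.integral_prod_right.aestronglyMeasurable
    · simpa using norm_integral_le_of_norm_le_const (hb _ _ fun x => (hA.2 h C hm hC).2 _ _)
  have hshift : ∀ h (t : ℝ), 0 ≤ t → ∀ r ∈ Set.uIcc (0 : ℝ) t,
      (∫ x, ξ x * A (s + r.toNNReal) h (coord (s + r.toNNReal) x)
        ∂(Q : Measure (SkorokhodSpace Opinion))) =
      ∫ x, ξ x * A (s + r).toNNReal h (coord (s + r).toNNReal x)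
        ∂(Q : Measure (SkorokhodSpace Opinion)) := by
    intro h t ht r hr
    rw [Set.uIcc_of_le ht] at hr
    rw [Real.toNNReal_add s.coe_nonneg hr.1, Real.toNNReal_coe]
  refine ⟨⟨K, fun t h C _ hm hC hC₀ => ?_⟩, fun h hh t ht => ?_, fun h hh t ht => ?_⟩
  · simpa using norm_integral_le_of_norm_le_const (hb _ _ fun x => hC _)
  · refine (intervalIntegrable_congr fun r hr =>
      hshift h t ht r (Set.uIoc_subset_uIcc hr)).2 ?_
    have := (hint h hh (s + 0) (s + t)).comp_add_left (c := (s : ℝ))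
    simpa using this
  · rw [intervalIntegral.integral_congr (hshift h t ht),
      intervalIntegral.integral_comp_add_left (fun r : ℝ => ∫ x, ξ x * A r.toNNReal h
        (coord r.toNNReal x) ∂(Q : Measure (SkorokhodSpace Opinion)))]
    have hM := integral_mul_martingale_sub (hQ h hh)
      (le_add_of_nonneg_right zero_le : s ≤ s + t.toNNReal) hξ hK
    simp_rw [dynkin_sub hA hh] at hM
    obtain ⟨hm, C, hC⟩ := hh
    have e1 : ((s + t.toNNReal : ℝ≥0) : ℝ) = s + t := by
      rw [NNReal.coe_add, Real.coe_toNNReal t ht]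
    have i1 : ∀ u : ℝ≥0, Integrable (fun x => ξ x * h (coord u x))
        (Q : Measure (SkorokhodSpace Opinion)) := fun u =>
      Integrable.of_bound (hξm.mul (hm.comp (measurable_coord u))).aestronglyMeasurable (K * C)
        (hb _ _ fun x => hC _)
    have i2 : Integrable (fun p : ℝ × SkorokhodSpace Opinion =>
        ξ p.2 * A p.1.toNNReal h (coord p.1.toNNReal p.2))
        ((volume.restrict (Set.Ioc (s : ℝ) (s + t))).prod
          (Q : Measure (SkorokhodSpace Opinion))) := by
      refine Integrable.of_bound (hjoint h ⟨hm, C, hC⟩).aestronglyMeasurable (K * (l * C)) ?_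
      have : ∀ᵐ p ∂((volume.restrict (Set.Ioc (s : ℝ) (s + t))).prod
          (Q : Measure (SkorokhodSpace Opinion))), |ξ p.2| ≤ K :=
        Measure.quasiMeasurePreserving_snd.ae hK
      filter_upwards [this] with p hp
      rw [norm_mul]
      exact mul_le_mul hp ((hA.2 h C hm hC).2 _ _) (norm_nonneg _) hK₀
    have e2 : ∀ x, ξ x * (h (coord (s + t.toNNReal) x) - h (coord s x)
        - ∫ r in (s : ℝ)..((s + t.toNNReal : ℝ≥0) : ℝ), A r.toNNReal h (coord r.toNNReal x)) =
        ξ x * h (coord (s + t.toNNReal) x) - ξ x * h (coord s x)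
        - ∫ r in Set.Ioc (s : ℝ) (s + t), ξ x * A r.toNNReal h (coord r.toNNReal x) := by
      intro x
      rw [e1, intervalIntegral.integral_of_le (by linarith), integral_const_mul]
      ring
    simp_rw [e2] at hM
    have i3 : Integrable (fun x => ξ x * h (coord (s + t.toNNReal) x) - ξ x * h (coord s x))
        (Q : Measure (SkorokhodSpace Opinion)) := (i1 _).sub (i1 _)
    have i4 : Integrable (fun x => ∫ r in Set.Ioc (s : ℝ) (s + t),
        ξ x * A r.toNNReal h (coord r.toNNReal x)) (Q : Measure (SkorokhodSpace Opinion)) :=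
      i2.integral_prod_right
    rw [integral_sub i3 i4, integral_sub (i1 _) (i1 _),
      ← integral_integral_swap (f := fun (r : ℝ) x => ξ x * A r.toNNReal h (coord r.toNNReal x)) i2] at hM
    rw [add_zero, intervalIntegral.integral_of_le (by linarith)]
    simp only [Real.toNNReal_zero, add_zero]
    linarith

theorem HasBoundedRate.shift (hA : HasBoundedRate A l) (s : ℝ≥0) :
    HasBoundedRate (fun r => A (s + r)) l := by
  refine ⟨hA.1, fun h C hm hC => ⟨?_, fun r x => (hA.2 h C hm hC).2 _ x⟩⟩
  have h1 : Measurable fun p : ℝ × Opinion => ((s : ℝ) + (p.1.toNNReal : ℝ), p.2) := by fun_prop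
  have h2 := (hA.2 h C hm hC).1.comp h1
  simp only [Function.comp_def, ← NNReal.coe_add, Real.toNNReal_coe] at h2
  exact h2

end MartingaleProblem

/-! ### Markov property, uniqueness in law, and marginals -/

section MarkovProperty

/-- Conditional expectation is self-adjoint: both sides equal the integral of `P[u | m] * P[v | m]`.
-/
theorem integral_mul_condExp {Ω : Type*} {m m0 : MeasurableSpace Ω} (hm : m ≤ m0) {P : Measure Ω}
    [IsProbabilityMeasure P] {u v : Ω → ℝ} {K C : ℝ≥0} (hu : Measurable u) (huK : ∀ x, |u x| ≤ K)
    (hv : Measurable v) (hvC : ∀ x, |v x| ≤ C) :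
    ∫ x, u x * (P[v | m]) x ∂P = ∫ x, (P[u | m]) x * v x ∂P := by
  have bu := ae_bdd_abs_condExp_of_ae_bdd_abs (m := m) (μ := P) (Eventually.of_forall huK)
  have bv := ae_bdd_abs_condExp_of_ae_bdd_abs (m := m) (μ := P) (Eventually.of_forall hvC)
  have iu : Integrable u P := Integrable.of_bound hu.aestronglyMeasurable K
    (Eventually.of_forall huK)
  have iv : Integrable v P := Integrable.of_bound hv.aestronglyMeasurable C
    (Eventually.of_forall hvC)
  have h1 : P[P[v | m] * u | m] =ᵐ[P] P[v | m] * P[u | m] :=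
    condExp_stronglyMeasurable_mul_of_bound hm stronglyMeasurable_condExp iu C bv
  have h2 : P[P[u | m] * v | m] =ᵐ[P] P[u | m] * P[v | m] :=
    condExp_stronglyMeasurable_mul_of_bound hm stronglyMeasurable_condExp iv K bu
  calc ∫ x, u x * (P[v | m]) x ∂P = ∫ x, (P[v | m] * u) x ∂P := by
        simp [mul_comm]
    _ = ∫ x, (P[P[v | m] * u | m]) x ∂P := (integral_condExp hm).symm
    _ = ∫ x, (P[P[u | m] * v | m]) x ∂P := by
        refine integral_congr_ae ?_
        filter_upwards [h1, h2] with x h1 h2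
        rw [h1, h2, Pi.mul_apply, Pi.mul_apply, mul_comm]
    _ = ∫ x, (P[u | m] * v) x ∂P := integral_condExp hm
    _ = ∫ x, (P[u | m]) x * v x ∂P := rfl

variable {A : ℝ≥0 → (Opinion → ℝ) → Opinion → ℝ} {l : ℝ}
  {Q Q' : ProbabilityMeasure (SkorokhodSpace Opinion)}

theorem comap_coord_le {s t : ℝ≥0} (h : s ≤ t) :
    MeasurableSpace.comap (coord s) inferInstance ≤ canonicalFiltration t :=
  (measurable_coord_canonicalFiltration h).comap_le

/-- The martingale problem implies the Markov property. -/
theorem markov_of_martingale (hA : HasBoundedRate A l)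
    (hQ : ∀ h, IsBoundedMeasurable h →
      Martingale (dynkin A h) canonicalFiltration (Q : Measure (SkorokhodSpace Opinion)))
    {h : Opinion → ℝ} (hh : IsBoundedMeasurable h) {s t : ℝ≥0} (hst : s ≤ t) :
    (Q : Measure (SkorokhodSpace Opinion))[fun x => h (coord t x) | canonicalFiltration s]
      =ᵐ[(Q : Measure (SkorokhodSpace Opinion))]
    (Q : Measure (SkorokhodSpace Opinion))[fun x => h (coord t x) |
      MeasurableSpace.comap (coord s) inferInstance] := by
  have hle := comap_coord_le (le_refl s)
  have hle' := hle.trans (canonicalFiltration.le s)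
  have hcoord : ∀ g : Opinion → ℝ, IsBoundedMeasurable g → ∀ u : ℝ≥0,
      Measurable (fun x => g (coord u x)) ∧ ∃ C : ℝ≥0, ∀ x, |g (coord u x)| ≤ C := by
    rintro g ⟨hg, C, hC⟩ u
    exact ⟨hg.comp (measurable_coord u), C.toNNReal, fun x =>
      (hC _).trans (Real.le_coe_toNNReal C)⟩
  obtain ⟨hmt, Ct, hCt⟩ := hcoord h hh t
  symm
  refine ae_eq_condExp_of_forall_setIntegral_eq (canonicalFiltration.le s)
    (Integrable.of_bound hmt.aestronglyMeasurable Ct (Eventually.of_forall hCt))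
    (fun _ _ _ => integrable_condExp.integrableOn) (fun B hB _ => ?_)
    (stronglyMeasurable_condExp.mono hle).aestronglyMeasurable
  have hB' : MeasurableSet B := canonicalFiltration.le s B hB
  set ξ : SkorokhodSpace Opinion → ℝ := B.indicator 1 with hξ
  have hξ1 : ∀ x, |ξ x| ≤ (1 : ℝ≥0) := fun x => by
    by_cases hx : x ∈ B <;> simp [hξ, hx]
  have hset : ∀ f : SkorokhodSpace Opinion → ℝ,
      ∫ x in B, f x ∂(Q : Measure (SkorokhodSpace Opinion)) =
        ∫ x, ξ x * f x ∂(Q : Measure (SkorokhodSpace Opinion)) := by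
    intro f
    rw [← integral_indicator hB']
    congr 1
    ext x
    by_cases hx : x ∈ B <;> simp [hξ, hx]
  have hξm : Measurable[canonicalFiltration s] ξ :=
    (@measurable_one ℝ (SkorokhodSpace Opinion) _ (canonicalFiltration s) _).indicator hB
  have hξm' : Measurable ξ := measurable_one.indicator hB'
  -- The weights 1_B and E[1_B | X_s] give the same functional at time `s`, where only functions of
  -- X_s are tested. By uniqueness they agree at time `t`, and self-adjointness transfers the
  -- conditioning from 1_B to h(X_t).
  have f1 := isLinearFlow_weighted hA hQ hξm (Eventually.of_forall hξ1)
  have f2 := isLinearFlow_weighted hA hQ (s := s)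
    (ξ := (Q : Measure (SkorokhodSpace Opinion))[ξ | MeasurableSpace.comap (coord s) inferInstance])
    (stronglyMeasurable_condExp.mono hle).measurable
    (ae_bdd_abs_condExp_of_ae_bdd_abs (Eventually.of_forall hξ1))
  have key := f1.unique (hA.shift s) f2 ?_ (t - s).coe_nonneg hh
  · rw [Real.toNNReal_coe, add_tsub_cancel_of_le hst] at key
    rw [hset, hset, key]
    exact integral_mul_condExp hle' hξm' hξ1 hmt hCt
  · intro g hg
    obtain ⟨hms, Cs, hCs⟩ := hcoord g hg s
    rw [Real.toNNReal_zero, add_zero, ← integral_mul_condExp hle' hξm' hξ1 hms hCs]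
    refine integral_congr_ae (Eventually.of_forall fun x => ?_)
    have : StronglyMeasurable[MeasurableSpace.comap (coord s) inferInstance]
        fun x => g (coord s x) := (hg.1.comp (comap_measurable _)).stronglyMeasurable
    rw [condExp_of_stronglyMeasurable hle' this
      (Integrable.of_bound hms.aestronglyMeasurable Cs (Eventually.of_forall hCs))]

theorem integral_coord_zero {m₀ : ProbabilityMeasure Opinion}
    (h0 : (Q : Measure (SkorokhodSpace Opinion)).map (coord 0) = (m₀ : Measure Opinion))
    {h : Opinion → ℝ} (hh : IsBoundedMeasurable h) :
    ∫ x, h (coord 0 x) ∂(Q : Measure (SkorokhodSpace Opinion)) =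
      ∫ x, h x ∂(m₀ : Measure Opinion) := by
  rw [← h0, integral_map (measurable_coord 0).aemeasurable hh.1.aestronglyMeasurable]

/-- The finite-dimensional distributions are determined by the martingale problem. -/
theorem integral_prod_coord_eq (hA : HasBoundedRate A l) {m₀ : ProbabilityMeasure Opinion}
    (hQ : IsMarkovLaw A m₀ Q) (hQ' : IsMarkovLaw A m₀ Q') {f : ℝ≥0 → Opinion → ℝ}
    (hf : ∀ j, Measurable (f j)) (hf1 : ∀ j x, |f j x| ≤ 1) (J : Finset ℝ≥0) :
    ∀ s : ℝ≥0, (∀ j ∈ J, j ≤ s) → ∀ h : Opinion → ℝ, IsBoundedMeasurable h →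
      ∫ x, (∏ j ∈ J, f j (coord j x)) * h (coord s x) ∂(Q : Measure (SkorokhodSpace Opinion)) =
      ∫ x, (∏ j ∈ J, f j (coord j x)) * h (coord s x)
        ∂(Q' : Measure (SkorokhodSpace Opinion)) := by
  -- Equality at a time `u` after all of `J` propagates to every later time, the product over `J`
  -- being a weight known at time `u`.
  have step : ∀ (J : Finset ℝ≥0) (u : ℝ≥0), (∀ j ∈ J, j ≤ u) →
      (∀ h : Opinion → ℝ, IsBoundedMeasurable h →
        ∫ x, (∏ j ∈ J, f j (coord j x)) * h (coord u x) ∂(Q : Measure (SkorokhodSpace Opinion)) =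
        ∫ x, (∏ j ∈ J, f j (coord j x)) * h (coord u x)
          ∂(Q' : Measure (SkorokhodSpace Opinion))) →
      ∀ s : ℝ≥0, u ≤ s → ∀ h : Opinion → ℝ, IsBoundedMeasurable h →
        ∫ x, (∏ j ∈ J, f j (coord j x)) * h (coord s x) ∂(Q : Measure (SkorokhodSpace Opinion)) =
        ∫ x, (∏ j ∈ J, f j (coord j x)) * h (coord s x)
          ∂(Q' : Measure (SkorokhodSpace Opinion)) := by
    intro J u hJ hu s hs h hh
    have hξ : Measurable[canonicalFiltration u] fun x => ∏ j ∈ J, f j (coord j x) :=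
      Finset.measurable_prod _ fun j hj =>
        (hf j).comp (measurable_coord_canonicalFiltration (hJ j hj))
    have hξ1 : ∀ x, |∏ j ∈ J, f j (coord j x)| ≤ 1 := fun x => by
      rw [Finset.abs_prod]
      exact Finset.prod_le_one (fun _ _ => abs_nonneg _) fun j _ => hf1 j _
    have f1 := isLinearFlow_weighted hA hQ.generator hξ (Eventually.of_forall hξ1)
    have f2 := isLinearFlow_weighted hA hQ'.generator hξ (Eventually.of_forall hξ1)
    have key := f1.unique (hA.shift u) f2 (fun g hg => by simpa using hu g hg)
      (s - u).coe_nonneg hh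
    rwa [Real.toNNReal_coe, add_tsub_cancel_of_le hs] at key
  induction J using Finset.induction_on_max with
  | empty =>
    intro s _ h hh
    refine step ∅ 0 (by simp) (fun g hg => ?_) s zero_le h hh
    simp only [Finset.prod_empty, one_mul]
    rw [integral_coord_zero hQ.initial hg, integral_coord_zero hQ'.initial hg]
  | insert a J ha ih =>
    intro s hs h hh
    refine step (insert a J) a ?_ (fun g hg => ?_) s (hs a (Finset.mem_insert_self _ _)) h hh
    · intro j hj
      rcases Finset.mem_insert.1 hj with rfl | hj
      · exact le_rfl
      · exact (ha j hj).le
    · have hn : a ∉ J := fun h => lt_irrefl _ (ha a h)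
      obtain ⟨hgm, C, hC⟩ := hg
      -- At the largest time `a`, the factor `f a` merges with the test function, which reduces the
      -- claim to the smaller set.
      have := ih a (fun j hj => (ha j hj).le) (fun x => f a x * g x)
        ⟨(hf a).mul hgm, C, fun x => by
          rw [abs_mul]
          calc |f a x| * |g x| ≤ 1 * C :=
                mul_le_mul (hf1 a x) (hC x) (abs_nonneg _) zero_le_one
            _ = C := one_mul C⟩
      simp_rw [Finset.prod_insert hn]
      convert this using 3 with x x
      · ring
      · ring

/-- Cylinders form a π-system generating the product σ-field, so the images of the laws in the full
product space agree. The σ-field of the path space is the trace of that one. -/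
theorem IsMarkovLaw.unique (hA : HasBoundedRate A l) {m₀ : ProbabilityMeasure Opinion}
    (hQ : IsMarkovLaw A m₀ Q) (hQ' : IsMarkovLaw A m₀ Q') : Q = Q' := by
  have hval : Measurable (Subtype.val : SkorokhodSpace Opinion → ℝ≥0 → Opinion) :=
    measurable_subtype_coe
  have hP : IsProbabilityMeasure ((Q : Measure (SkorokhodSpace Opinion)).map Subtype.val) :=
    Measure.isProbabilityMeasure_map hval.aemeasurable
  have hP' : IsProbabilityMeasure ((Q' : Measure (SkorokhodSpace Opinion)).map Subtype.val) :=
    Measure.isProbabilityMeasure_map hval.aemeasurable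
  have hmap : (Q : Measure (SkorokhodSpace Opinion)).map Subtype.val =
      (Q' : Measure (SkorokhodSpace Opinion)).map Subtype.val := by
    refine ext_of_generate_finite _ generateFrom_squareCylinders.symm
      (isPiSystem_squareCylinders (fun _ => MeasurableSpace.isPiSystem_measurableSet)
        fun _ => by simp) ?_ (by rw [measure_univ, measure_univ])
    rintro S ⟨J, B, hB, rfl⟩
    have hB : ∀ j, MeasurableSet (B j) := fun j => hB j (Set.mem_univ j)
    have hS : MeasurableSet ((J : Set ℝ≥0).pi B) :=
      MeasurableSet.pi J.countable_toSet fun j _ => hB j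
    rw [Measure.map_apply hval hS, Measure.map_apply hval hS]
    -- The final time `J.sup id` only has to dominate `J`, since the test function there is the
    -- constant `1`.
    have key := integral_prod_coord_eq hA hQ hQ' (f := fun j => (B j).indicator 1)
      (fun j => measurable_one.indicator (hB j)) (fun j x => by
        by_cases hx : x ∈ B j <;> simp [hx]) J (J.sup id) (fun j hj => Finset.le_sup (f := id) hj)
      (fun _ => 1) ⟨measurable_const, 1, fun _ => by simp⟩
    have e : ∀ x : SkorokhodSpace Opinion,
        (∏ j ∈ J, (B j).indicator (1 : Opinion → ℝ) (coord j x)) * 1 =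
          (Subtype.val ⁻¹' ((J : Set ℝ≥0).pi B)).indicator 1 x := by
      intro x
      rw [mul_one]
      by_cases hx : x ∈ (Subtype.val ⁻¹' ((J : Set ℝ≥0).pi B) : Set (SkorokhodSpace Opinion))
      · rw [Set.indicator_of_mem hx]
        exact Finset.prod_eq_one fun j hj => Set.indicator_of_mem (hx j hj) _
      · rw [Set.indicator_of_notMem hx]
        have : ∃ j ∈ J, x.1 j ∉ B j := by
          by_contra! hc
          exact hx fun j hj => hc j hj
        obtain ⟨j, hj, hxj⟩ := this
        exact Finset.prod_eq_zero hj (Set.indicator_of_notMem hxj _)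
    simp_rw [e] at key
    rw [integral_indicator_one (hval hS), integral_indicator_one (hval hS)] at key
    exact (measureReal_eq_measureReal_iff).1 key
  refine Subtype.ext (Measure.ext fun S hS => ?_)
  obtain ⟨T, hT, rfl⟩ := hS
  have := congrArg (fun μ => μ T) hmap
  simp only [Measure.map_apply hval hT] at this
  exact this

/-- With weight `1` and starting time `0`, the marginals of `Q` solve the linear equation solved by
`m`, with the same initial value. -/
theorem IsMarkovLaw.map_coord {w : Opinion} {Δ : ℝ} {m₀ : ProbabilityMeasure Opinion}
    {m : ℝ≥0 → ProbabilityMeasure Opinion} (hm : IsSolution w Δ m₀ m)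
    (hQ : IsMarkovLaw (fun t => Deffuant.generator w Δ (m t)) m₀ Q) (t : ℝ≥0) :
    (Q : Measure (SkorokhodSpace Opinion)).map (coord t) = (m t : Measure Opinion) := by
  have hP : IsProbabilityMeasure ((Q : Measure (SkorokhodSpace Opinion)).map (coord t)) :=
    Measure.isProbabilityMeasure_map (measurable_coord t).aemeasurable
  have f1 := isLinearFlow_weighted (s := 0) (ξ := fun _ => 1) (K := 1) hm.hasBoundedRate
    hQ.generator measurable_const (Eventually.of_forall fun _ => by simp)
  simp only [zero_add, one_mul] at f1
  refine ext_of_integral fun h hh h1 => ?_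
  have key := f1.unique hm.hasBoundedRate hm.isLinearFlow (fun g hg => ?_) t.coe_nonneg
    ⟨hh, 1, h1⟩
  · rw [Real.toNNReal_coe] at key
    rw [← key, integral_map (measurable_coord t).aemeasurable hh.aestronglyMeasurable]
  · rw [Real.toNNReal_zero, integral_coord_zero hQ.initial hg, hm.1]

end MarkovProperty

/-! ### Resampling a coordinate, and exponential times -/

section Preliminaries

theorem measurable_update {ι : Type*} [DecidableEq ι] {X : ι → Type*}
    [∀ i, MeasurableSpace (X i)] (i : ι) :
    Measurable fun p : (∀ j, X j) × X i => Function.update p.1 i p.2 := by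
  refine measurable_pi_iff.2 fun j => ?_
  by_cases hj : j = i
  · subst hj
    simpa using measurable_snd
  · simp only [Function.update_of_ne hj]
    exact (measurable_pi_apply j).comp measurable_fst

/-- Replacing one coordinate by an independent copy preserves a product law. This permits
integrating out a single noise variable while the others stay fixed. -/
theorem map_update_infinitePi {ι : Type*} [DecidableEq ι] {X : ι → Type*}
    [∀ i, MeasurableSpace (X i)] (μ : ∀ i, Measure (X i)) [∀ i, IsProbabilityMeasure (μ i)]
    (i : ι) :
    ((Measure.infinitePi μ).prod (μ i)).map (fun p => Function.update p.1 i p.2) =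
      Measure.infinitePi μ := by
  have hm := measurable_update (X := X) i
  refine Measure.eq_infinitePi μ fun s t ht => ?_
  rw [Measure.map_apply hm (MeasurableSet.pi s.countable_toSet fun j _ => ht j)]
  by_cases hi : i ∈ s
  · have e : (fun p : (∀ j, X j) × X i => Function.update p.1 i p.2) ⁻¹' ((s : Set ι).pi t) =
        (((s.erase i : Finset ι) : Set ι).pi t) ×ˢ t i := by
      ext ⟨ω, e⟩
      simp only [Set.mem_preimage, Set.mem_pi, Finset.mem_coe, Set.mem_prod, Finset.mem_erase]
      constructor
      · intro h
        refine ⟨fun j hj => ?_, by simpa using h i hi⟩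
        simpa [Function.update_of_ne hj.1] using h j hj.2
      · rintro ⟨h1, h2⟩ j hj
        by_cases hji : j = i
        · subst hji
          simpa using h2
        · simpa [Function.update_of_ne hji] using h1 j ⟨hji, hj⟩
    rw [e, Measure.prod_prod, Measure.infinitePi_pi _ fun j _ => ht j,
      Finset.prod_erase_mul _ _ hi]
  · have e : (fun p : (∀ j, X j) × X i => Function.update p.1 i p.2) ⁻¹' ((s : Set ι).pi t) =
        ((s : Set ι).pi t) ×ˢ Set.univ := by
      ext ⟨ω, e⟩
      simp only [Set.mem_preimage, Set.mem_pi, Finset.mem_coe, Set.mem_prod, Set.mem_univ,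
        and_true]
      refine forall₂_congr fun j hj => ?_
      rw [Function.update_of_ne (show j ≠ i from fun h => hi (h ▸ hj))]
    rw [e, Measure.prod_prod, Measure.infinitePi_pi _ fun j _ => ht j, measure_univ, mul_one]

theorem measurable_intervalIntegral_endpoints {α : Type*} [MeasurableSpace α] {u v : α → ℝ}
    (hu : Measurable u) (hv : Measurable v) {f : α × ℝ → ℝ} (hf : Measurable f) :
    Measurable fun x => ∫ r in (u x)..(v x), f (x, r) := by
  have key : ∀ u v : α → ℝ, Measurable u → Measurable v →
      Measurable fun x => ∫ r in Set.Ioc (u x) (v x), f (x, r) := by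
    intro u v hu hv
    have hs : MeasurableSet {p : α × ℝ | u p.1 < p.2 ∧ p.2 ≤ v p.1} :=
      (measurableSet_lt (hu.comp measurable_fst) measurable_snd).inter
        (measurableSet_le measurable_snd (hv.comp measurable_fst))
    have := (hf.indicator hs).stronglyMeasurable.integral_prod_right' (ν := volume)
    convert this.measurable using 2 with x
    rw [← integral_indicator measurableSet_Ioc]
    rfl
  exact (key u v hu hv).sub (key v u hv hu)

theorem expMeasure_real_Ici {v : ℝ} (hv : 0 ≤ v) :
    (expMeasure 2).real (Set.Ici v) = Real.exp (-(2 * v)) := by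
  have := isProbabilityMeasure_expMeasure (r := 2) two_pos
  have hac : expMeasure 2 ≪ volume := withDensity_absolutelyContinuous _ _
  have h1 : (expMeasure 2).real (Set.Ici v) = (expMeasure 2).real (Set.Ioi v) :=
    measureReal_congr (hac.ae_eq Ioi_ae_eq_Ici.symm)
  have h2 := cdf_expMeasure_eq (r := 2) two_pos v
  rw [cdf_eq_real, if_pos hv] at h2
  have h3 : (expMeasure 2).real (Set.Ioi v) = 1 - (expMeasure 2).real (Set.Iic v) := by
    rw [← Set.compl_Iic, probReal_compl_eq_one_sub measurableSet_Iic]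
  rw [h1, h3, h2]
  ring

theorem integral_expMeasure (f : ℝ → ℝ) :
    ∫ e, f e ∂(expMeasure 2) = ∫ e in Set.Ioi (0 : ℝ), 2 * Real.exp (-(2 * e)) * f e := by
  have h1 : expMeasure 2 = volume.withDensity (exponentialPDF 2) := rfl
  have hm : Measurable (exponentialPDF 2) := (measurable_exponentialPDFReal 2).ennreal_ofReal
  rw [h1, integral_withDensity_eq_integral_toReal_smul hm (Eventually.of_forall fun _ =>
    ENNReal.ofReal_lt_top), ← integral_Ici_eq_integral_Ioi, ← integral_indicator measurableSet_Ici]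
  congr 1
  ext e
  by_cases he : 0 ≤ e
  · rw [Set.indicator_of_mem (by exact he), exponentialPDF_of_nonneg he,
      ENNReal.toReal_ofReal (by positivity), smul_eq_mul]
  · rw [Set.indicator_of_notMem (by exact he), exponentialPDF_of_neg (by linarith)]
    simp

theorem ae_pos_expMeasure : ∀ᵐ e ∂(expMeasure 2), 0 < e := by
  have h1 : (expMeasure 2) (Set.Iic 0) = 0 := by
    have h1 : expMeasure 2 = volume.withDensity (exponentialPDF 2) := rfl
    rw [h1, withDensity_apply _ measurableSet_Iic,
      lintegral_exponentialPDF_eq_antiDeriv two_pos]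
    simp
  rw [ae_iff]
  simpa [Set.Iic] using h1

/-- For an exponential time `E` of rate `2`, `2 𝔼 ∫₀ᴱ g = 𝔼 g(E)`. -/
theorem two_mul_integral_expMeasure_integral {g : ℝ → ℝ} (hg : Measurable g) {K : ℝ}
    (hK : ∀ v, |g v| ≤ K) :
    2 * ∫ e, (∫ v in (0 : ℝ)..(e.toNNReal : ℝ), g v) ∂(expMeasure 2) =
      ∫ e, g (e.toNNReal : ℝ) ∂(expMeasure 2) := by
  have hP := isProbabilityMeasure_expMeasure (r := 2) two_pos
  -- With f(v, e) = g(v) 1_{v ≤ e}, Fubini gives E∫₀ᴱ g = ∫ g(v) P(E ≥ v) dv, and twice P(E ≥ v) =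
  -- e^{-2v} is the density of E.
  set f : ℝ → ℝ → ℝ := fun v e => (Set.Ici v).indicator (fun _ => g v) e with hf
  have hfm : Measurable (Function.uncurry f) := by
    have hs : MeasurableSet {p : ℝ × ℝ | p.1 ≤ p.2} :=
      measurableSet_le measurable_fst measurable_snd
    exact (hg.comp measurable_fst).indicator hs
  have hexp : ∀ v ∈ Set.Ioi (0 : ℝ), ∀ c : ℝ,
      ∫ e, (Set.Ici v).indicator (fun _ => c) e ∂(expMeasure 2) = Real.exp (-(2 * v)) * c := by
    intro v hv c
    rw [integral_indicator_const _ measurableSet_Ici, expMeasure_real_Ici (le_of_lt hv),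
      smul_eq_mul]
  have hint : Integrable (Function.uncurry f)
      ((volume.restrict (Set.Ioi (0 : ℝ))).prod (expMeasure 2)) := by
    rw [integrable_prod_iff hfm.aestronglyMeasurable]
    constructor
    · refine Eventually.of_forall fun v => ?_
      exact (integrable_const (g v)).indicator measurableSet_Ici
    · have hi : Integrable (fun v : ℝ => Real.exp (-(2 * v)) * |g v|)
          (volume.restrict (Set.Ioi (0 : ℝ))) := by
        have h0 : Integrable (fun v : ℝ => Real.exp (-(2 * v)))
            (volume.restrict (Set.Ioi (0 : ℝ))) := by
          have := exp_neg_integrableOn_Ioi 0 (two_pos (α := ℝ))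
          simpa [IntegrableOn] using this
        have := h0.bdd_mul (f := fun v => |g v|) (c := K)
          (hg.abs.aestronglyMeasurable) (Eventually.of_forall fun v => by simpa using hK v)
        simpa [mul_comm] using this
      refine hi.congr ((ae_restrict_iff' measurableSet_Ioi).2 (Eventually.of_forall fun v hv => ?_))
      dsimp only
      rw [← hexp v hv]
      congr 1
      ext e
      by_cases he : e ∈ Set.Ici v <;> simp [Function.uncurry, hf, he]
  have e1 : ∀ᵐ e ∂(expMeasure 2), ∫ v in (0 : ℝ)..(e.toNNReal : ℝ), g v =
      ∫ v in Set.Ioi (0 : ℝ), f v e := by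
    filter_upwards [ae_pos_expMeasure] with e he
    rw [Real.coe_toNNReal e he.le, intervalIntegral.integral_of_le he.le,
      ← integral_indicator measurableSet_Ioc, ← integral_indicator measurableSet_Ioi]
    congr 1
    ext v
    by_cases h1 : 0 < v <;> by_cases h2 : v ≤ e <;> simp [hf, Set.indicator, h1, h2]
  have e2 : ∀ᵐ e ∂(expMeasure 2), g (e.toNNReal : ℝ) = g e := by
    filter_upwards [ae_pos_expMeasure] with e he
    rw [Real.coe_toNNReal e he.le]
  rw [integral_congr_ae e1, integral_congr_ae e2, integral_expMeasure g,
    ← integral_integral_swap hint, ← integral_const_mul]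
  refine setIntegral_congr_fun measurableSet_Ioi fun v hv => ?_
  simp only [hf]
  rw [hexp v hv]
  ring

/-- Strict because the exponential time is almost surely positive; its powers then decay, which
excludes explosion. -/
theorem integral_exp_neg_expMeasure :
    ∫ e, Real.exp (-(e.toNNReal : ℝ)) ∂(expMeasure 2) < 1 := by
  have hP := isProbabilityMeasure_expMeasure (r := 2) two_pos
  have hi : Integrable (fun e : ℝ => Real.exp (-(e.toNNReal : ℝ))) (expMeasure 2) :=
    Integrable.of_bound (Measurable.aestronglyMeasurable (by fun_prop)) 1
      (Eventually.of_forall fun e => by simp)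
  have hsub : ∫ e, (1 - Real.exp (-(e.toNNReal : ℝ))) ∂(expMeasure 2) =
      1 - ∫ e, Real.exp (-(e.toNNReal : ℝ)) ∂(expMeasure 2) := by
    rw [integral_sub (integrable_const 1) hi]
    simp
  have hnn : ∀ e : ℝ, 0 ≤ 1 - Real.exp (-(e.toNNReal : ℝ)) := fun e => by simp
  have hle := integral_nonneg (μ := expMeasure 2)
    (f := fun e : ℝ => 1 - Real.exp (-(e.toNNReal : ℝ))) hnn
  have hne : ∫ e, (1 - Real.exp (-(e.toNNReal : ℝ))) ∂(expMeasure 2) ≠ 0 := by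
    intro h0
    have h1 := (integral_eq_zero_iff_of_nonneg hnn ((integrable_const 1).sub hi)).1 h0
    have : ∀ᵐ e ∂(expMeasure 2), False := by
      filter_upwards [h1, ae_pos_expMeasure] with e he hpos
      simp only [Pi.zero_apply] at he
      rw [Real.coe_toNNReal e hpos.le] at he
      have : Real.exp (-e) < 1 := by simpa using hpos
      linarith
    simpa using this.exists
  rw [hsub] at hle hne
  exact lt_of_le_of_ne (by linarith) fun h => hne (by linarith)

end Preliminaries

/-! ### Càdlàg paths built from waiting times and marks -/

section Paths

/-- The space of the waiting times and marks of a pure jump process. -/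
abbrev Noise : Type := ℕ → ℝ × Opinion

/-- The jump times. -/
def jumpTime (ω : Noise) : ℕ → ℝ≥0
  | 0 => 0
  | n + 1 => jumpTime ω n + (ω (n + 1)).1.toNNReal

variable (Ψ : ℝ≥0 → Opinion → Opinion → Opinion) (ψ : Opinion → Opinion)

/-- The states after each jump; `Ψ t z u` is the state after a jump from `z` at time `t` with mark
`u`, and `ψ u` the initial state. -/
def jumpState (ω : Noise) : ℕ → Opinion
  | 0 => ψ (ω 0).2
  | n + 1 => Ψ (jumpTime ω (n + 1)) (jumpState ω n) (ω (n + 1)).2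

/-- The path in which only the first `n` jumps are performed. -/
def pathUpTo (ω : Noise) : ℕ → ℝ≥0 → Opinion
  | 0 => fun _ => jumpState Ψ ψ ω 0
  | n + 1 => fun t => if jumpTime ω (n + 1) ≤ t then jumpState Ψ ψ ω (n + 1) else pathUpTo ω n t

variable {Ψ ψ} {ω : Noise}

theorem jumpTime_mono (ω : Noise) : Monotone (jumpTime ω) :=
  monotone_nat_of_le_succ fun n => by
    rw [jumpTime]
    exact le_self_add

theorem pathUpTo_succ_of_lt {n : ℕ} {t : ℝ≥0} (h : t < jumpTime ω (n + 1)) :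
    pathUpTo Ψ ψ ω (n + 1) t = pathUpTo Ψ ψ ω n t := by
  exact if_neg (not_le.2 h)

theorem pathUpTo_of_le {n : ℕ} {t : ℝ≥0} (h : jumpTime ω n ≤ t) :
    pathUpTo Ψ ψ ω n t = jumpState Ψ ψ ω n := by
  cases n with
  | zero => rfl
  | succ n => exact if_pos h

theorem pathUpTo_eq_of_lt {n k : ℕ} (hnk : n ≤ k) {t : ℝ≥0} (h : t < jumpTime ω (n + 1)) :
    pathUpTo Ψ ψ ω k t = pathUpTo Ψ ψ ω n t := by
  induction k, hnk using Nat.le_induction with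
  | base => rfl
  | succ k hk ih =>
    rw [pathUpTo_succ_of_lt (h.trans_le (jumpTime_mono ω (by omega))), ih]

theorem isCadlag_const {S : Type*} [TopologicalSpace S] (z : S) :
    IsCadlag fun _ : ℝ≥0 => z :=
  fun _ => ⟨continuousWithinAt_const, z, tendsto_const_nhds⟩

theorem IsCadlag.ite {S : Type*} [TopologicalSpace S] {x : ℝ≥0 → S} (hx : IsCadlag x) (T : ℝ≥0)
    (z : S) : IsCadlag fun t => if T ≤ t then z else x t := by
  intro t
  constructor
  · by_cases h : T ≤ t
    · refine (continuousWithinAt_const (b := z)).congr (fun u hu => ?_) ?_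
      · rw [if_pos (h.trans hu)]
      · rw [if_pos h]
    · refine (hx t).1.congr_of_eventuallyEq ?_ (by rw [if_neg h])
      filter_upwards [mem_nhdsWithin_of_mem_nhds (Iio_mem_nhds (not_le.1 h))] with u hu
      rw [if_neg (not_le.2 hu)]
  · by_cases h : T < t
    · refine ⟨z, tendsto_const_nhds.congr' ?_⟩
      filter_upwards [mem_nhdsWithin_of_mem_nhds (Ioi_mem_nhds h)] with u hu
      rw [if_pos (le_of_lt hu)]
    · obtain ⟨l, hl⟩ := (hx t).2
      refine ⟨l, hl.congr' ?_⟩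
      filter_upwards [self_mem_nhdsWithin] with u hu
      rw [if_neg (not_le.2 (lt_of_lt_of_le hu (not_lt.1 h)))]

theorem isCadlag_of_locally {S : Type*} [TopologicalSpace S] {x : ℝ≥0 → S}
    (h : ∀ t, ∃ y, IsCadlag y ∧ ∃ T, t < T ∧ ∀ u < T, x u = y u) : IsCadlag x := by
  intro t
  obtain ⟨y, hy, T, hT, he⟩ := h t
  have hn : ∀ s : Set ℝ≥0, x =ᶠ[𝓝[s] t] y := fun s => by
    filter_upwards [mem_nhdsWithin_of_mem_nhds (Iio_mem_nhds hT)] with u hu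
    exact he u hu
  refine ⟨(hy t).1.congr_of_eventuallyEq (hn _) (he t hT), ?_⟩
  obtain ⟨l, hl⟩ := (hy t).2
  exact ⟨l, hl.congr' (hn _).symm⟩

theorem isCadlag_pathUpTo (ω : Noise) (n : ℕ) : IsCadlag (pathUpTo Ψ ψ ω n) := by
  induction n with
  | zero => exact isCadlag_const _
  | succ n ih => exact ih.ite _ _

/-- The jump times tend to infinity. -/
def NonExplosive (ω : Noise) : Prop := ∀ K : ℕ, ∃ n, (K : ℝ≥0) < jumpTime ω n

theorem NonExplosive.exists_lt (h : NonExplosive ω) (t : ℝ≥0) : ∃ n, t < jumpTime ω (n + 1) := by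
  obtain ⟨K, hK⟩ := exists_nat_ge t
  obtain ⟨n, hn⟩ := h K
  exact ⟨n, hK.trans_lt (hn.trans_le (jumpTime_mono ω (Nat.le_succ n)))⟩

open scoped Classical in
/-- The value at time `t` of the path of the jump process. -/
def pathFun (Ψ : ℝ≥0 → Opinion → Opinion → Opinion) (ψ : Opinion → Opinion) (ω : Noise)
    (t : ℝ≥0) : Opinion :=
  if h : NonExplosive ω then pathUpTo Ψ ψ ω (Nat.find (h.exists_lt t)) t else pathUpTo Ψ ψ ω 0 t

/-- Jumps after time `t` do not affect the value at `t`, so any sufficiently large number of jumps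
may replace the minimal one. -/
theorem pathFun_eq (h : NonExplosive ω) {n : ℕ} {t : ℝ≥0} (ht : t < jumpTime ω (n + 1)) :
    pathFun Ψ ψ ω t = pathUpTo Ψ ψ ω n t := by
  classical
  rw [pathFun, dif_pos h]
  have h1 := Nat.find_min' (h.exists_lt t) ht
  have h2 := Nat.find_spec (h.exists_lt t)
  convert (pathUpTo_eq_of_lt h1 h2).symm

theorem isCadlag_pathFun (ω : Noise) : IsCadlag (pathFun Ψ ψ ω) := by
  by_cases h : NonExplosive ω
  · refine isCadlag_of_locally fun t => ?_
    obtain ⟨n, hn⟩ := h.exists_lt t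
    exact ⟨_, isCadlag_pathUpTo ω n, _, hn, fun u hu => pathFun_eq h hu⟩
  · have : pathFun Ψ ψ ω = pathUpTo Ψ ψ ω 0 := by
      funext t
      rw [pathFun, dif_neg h]
    rw [this]
    exact isCadlag_pathUpTo ω 0

/-- The path of the jump process. -/
def jumpPath (Ψ : ℝ≥0 → Opinion → Opinion → Opinion) (ψ : Opinion → Opinion) (ω : Noise) :
    SkorokhodSpace Opinion := ⟨pathFun Ψ ψ ω, isCadlag_pathFun ω⟩

/-- The path of the jump process in which only the first `n` jumps are performed. -/
def jumpPathUpTo (Ψ : ℝ≥0 → Opinion → Opinion → Opinion) (ψ : Opinion → Opinion) (n : ℕ)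
    (ω : Noise) : SkorokhodSpace Opinion := ⟨pathUpTo Ψ ψ ω n, isCadlag_pathUpTo ω n⟩

theorem measurable_jumpTime (n : ℕ) : Measurable fun ω => jumpTime ω n := by
  induction n with
  | zero => exact measurable_const
  | succ n ih =>
    exact ih.add (measurable_real_toNNReal.comp
      (measurable_fst.comp (measurable_pi_apply (n + 1))))

theorem measurable_jumpState
    (hΨ : Measurable fun p : ℝ≥0 × Opinion × Opinion => Ψ p.1 p.2.1 p.2.2)
    (hψ : Measurable ψ) (n : ℕ) :
    Measurable fun ω => jumpState Ψ ψ ω n := by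
  induction n with
  | zero => exact hψ.comp (measurable_snd.comp (measurable_pi_apply 0))
  | succ n ih =>
    exact hΨ.comp ((measurable_jumpTime (n + 1)).prodMk
      (ih.prodMk (measurable_snd.comp (measurable_pi_apply (n + 1)))))

theorem measurable_pathUpTo
    (hΨ : Measurable fun p : ℝ≥0 × Opinion × Opinion => Ψ p.1 p.2.1 p.2.2)
    (hψ : Measurable ψ) (n : ℕ) (t : ℝ≥0) :
    Measurable fun ω => pathUpTo Ψ ψ ω n t := by
  induction n with
  | zero => exact measurable_jumpState hΨ hψ 0
  | succ n ih =>
    exact Measurable.ite (measurableSet_le (measurable_jumpTime _) measurable_const)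
      (measurable_jumpState hΨ hψ (n + 1)) ih

theorem measurable_jumpPathUpTo
    (hΨ : Measurable fun p : ℝ≥0 × Opinion × Opinion => Ψ p.1 p.2.1 p.2.2)
    (hψ : Measurable ψ) (n : ℕ) :
    Measurable (jumpPathUpTo Ψ ψ n) :=
  (measurable_pi_iff.2 fun t => measurable_pathUpTo hΨ hψ n t).subtype_mk

theorem measurable_jumpPath
    (hΨ : Measurable fun p : ℝ≥0 × Opinion × Opinion => Ψ p.1 p.2.1 p.2.2)
    (hψ : Measurable ψ) :
    Measurable (jumpPath Ψ ψ) := by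
  classical
  refine Measurable.subtype_mk (measurable_pi_iff.2 fun t => ?_)
  have hs : MeasurableSet {ω : Noise | NonExplosive ω} := by
    simp only [NonExplosive, Set.ofPred_forall, Set.ofPred_exists]
    exact MeasurableSet.iInter fun K => MeasurableSet.iUnion fun n =>
      measurableSet_lt measurable_const (measurable_jumpTime n)
  refine measurable_of_tendsto_metrizable (f := fun n ω =>
    if NonExplosive ω then pathUpTo Ψ ψ ω n t else pathUpTo Ψ ψ ω 0 t)
    (fun n => Measurable.ite hs (measurable_pathUpTo hΨ hψ n t) (measurable_pathUpTo hΨ hψ 0 t))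
    (tendsto_pi_nhds.2 fun ω => ?_)
  by_cases h : NonExplosive ω
  · obtain ⟨N, hN⟩ := h.exists_lt t
    refine tendsto_const_nhds.congr' ?_
    filter_upwards [eventually_ge_atTop N] with n hn
    rw [if_pos h, pathFun_eq h hN, pathUpTo_eq_of_lt hn hN]
  · simp only [if_neg h]
    rw [pathFun, dif_neg h]
    exact tendsto_const_nhds

/-- The first `n` jumps read only the noise up to index `n`, so resampling index `n + 1` leaves them
unchanged. -/
theorem jumpTime_update {n k : ℕ} (hk : k ≤ n) (e : ℝ × Opinion) :
    jumpTime (Function.update ω (n + 1) e) k = jumpTime ω k := by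
  induction k with
  | zero => rfl
  | succ k ih =>
    rw [jumpTime, jumpTime, ih (by omega), Function.update_of_ne (by omega)]

theorem jumpState_update {n k : ℕ} (hk : k ≤ n) (e : ℝ × Opinion) :
    jumpState Ψ ψ (Function.update ω (n + 1) e) k = jumpState Ψ ψ ω k := by
  induction k with
  | zero => rw [jumpState, jumpState, Function.update_of_ne (by omega)]
  | succ k ih =>
    rw [jumpState, jumpState, ih (by omega), Function.update_of_ne (by omega), jumpTime_update hk]

theorem pathUpTo_update {n k : ℕ} (hk : k ≤ n) (e : ℝ × Opinion) :
    pathUpTo Ψ ψ (Function.update ω (n + 1) e) k = pathUpTo Ψ ψ ω k := by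
  induction k with
  | zero => funext t; rw [pathUpTo, pathUpTo, jumpState_update (Nat.zero_le n)]
  | succ k ih =>
    funext t
    rw [pathUpTo, pathUpTo, ih (by omega), jumpState_update hk, jumpTime_update hk]

theorem jumpPathUpTo_update (n : ℕ) (e : ℝ × Opinion) :
    jumpPathUpTo Ψ ψ n (Function.update ω (n + 1) e) = jumpPathUpTo Ψ ψ n ω :=
  Subtype.ext (pathUpTo_update le_rfl e)

end Paths

/-! ### The law of the noise and non-explosion -/

section NoiseLaw

instance : IsProbabilityMeasure (expMeasure 2) := isProbabilityMeasure_expMeasure two_pos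

/-- The law of the waiting times and marks: independent, exponential of rate `2` and uniform. -/
def noiseLaw : Measure Noise :=
  Measure.infinitePi fun _ => (expMeasure 2).prod (volume : Measure Opinion)

instance : IsProbabilityMeasure noiseLaw := by
  unfold noiseLaw
  infer_instance

theorem integral_noiseLaw_update (i : ℕ) {F : Noise → ℝ} (hF : Measurable F) {K : ℝ}
    (hK : ∀ ω, |F ω| ≤ K) :
    ∫ ω, F ω ∂noiseLaw =
      ∫ ω, ∫ e, F (Function.update ω i e) ∂((expMeasure 2).prod (volume : Measure Opinion))
        ∂noiseLaw := by
  have h := map_update_infinitePi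
    (fun _ : ℕ => (expMeasure 2).prod (volume : Measure Opinion)) i
  have hb : IsBoundedMeasurable fun p : Noise × (ℝ × Opinion) => F (Function.update p.1 i p.2) :=
    ⟨hF.comp (measurable_update i), K, fun _ => hK _⟩
  calc ∫ ω, F ω ∂noiseLaw = ∫ ω, F ω ∂((noiseLaw.prod
        ((expMeasure 2).prod (volume : Measure Opinion))).map
          (fun p => Function.update p.1 i p.2)) := by
        unfold noiseLaw
        rw [h]
    _ = _ := by
        rw [integral_map (measurable_update i).aemeasurable hF.aestronglyMeasurable,
          integral_prod _ (hb.integrable _)]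

theorem integral_exp_neg_jumpTime (n : ℕ) :
    ∫ ω, Real.exp (-(jumpTime ω n : ℝ)) ∂noiseLaw =
      (∫ e, Real.exp (-(e.toNNReal : ℝ)) ∂(expMeasure 2)) ^ n := by
  induction n with
  | zero => simp [jumpTime]
  | succ n ih =>
    rw [integral_noiseLaw_update (n + 1) (K := 1) ?_ ?_]
    · have e1 : ∀ (ω : Noise) (e : ℝ × Opinion),
          Real.exp (-(jumpTime (Function.update ω (n + 1) e) (n + 1) : ℝ)) =
            Real.exp (-(jumpTime ω n : ℝ)) * Real.exp (-(e.1.toNNReal : ℝ)) := by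
        intro ω e
        rw [jumpTime, jumpTime_update le_rfl, Function.update_self, ← Real.exp_add]
        push_cast
        ring_nf
      simp_rw [e1, integral_const_mul]
      rw [integral_mul_const, ih, integral_fun_fst (fun e : ℝ => Real.exp (-(e.toNNReal : ℝ)))]
      simp [pow_succ]
    · exact Real.measurable_exp.comp
        (measurable_coe_nnreal_real.comp (measurable_jumpTime (n + 1))).neg
    · intro ω
      simp

/-- By Markov's inequality for exp(-T_n), all jump times stay below K with probability at most e^K
cⁿ for every n, where c < 1 is the Laplace transform of one waiting time. -/
theorem ae_nonExplosive : ∀ᵐ ω ∂noiseLaw, NonExplosive ω := by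
  have hint : ∀ n, Integrable (fun ω => Real.exp (-(jumpTime ω n : ℝ))) noiseLaw := fun n =>
    Integrable.of_bound (Real.measurable_exp.comp
        (measurable_coe_nnreal_real.comp (measurable_jumpTime n)).neg).aestronglyMeasurable 1
      (Eventually.of_forall fun ω => by simp)
  have hc0 : 0 ≤ ∫ e, Real.exp (-(e.toNNReal : ℝ)) ∂(expMeasure 2) :=
    integral_nonneg fun e => (Real.exp_pos _).le
  have hle : ∀ K : ℕ, ∀ᵐ ω ∂noiseLaw, ∃ n, (K : ℝ≥0) < jumpTime ω n := by
    intro K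
    rw [ae_iff]
    push Not
    have hbound : ∀ n : ℕ, noiseLaw.real {ω | ∀ n, jumpTime ω n ≤ K} ≤
        Real.exp K * (∫ e, Real.exp (-(e.toNNReal : ℝ)) ∂(expMeasure 2)) ^ n := by
      intro n
      have hm := mul_meas_ge_le_integral_of_nonneg
        (Eventually.of_forall fun ω => (Real.exp_pos (-(jumpTime ω n : ℝ))).le) (hint n)
        (Real.exp (-K))
      rw [integral_exp_neg_jumpTime] at hm
      have hsub : noiseLaw.real {ω | ∀ n, jumpTime ω n ≤ K} ≤
          noiseLaw.real {ω | Real.exp (-K) ≤ Real.exp (-(jumpTime ω n : ℝ))} := by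
        refine measureReal_mono fun ω hω => ?_
        have h1 : (jumpTime ω n : ℝ) ≤ K := by exact_mod_cast hω n
        exact Real.exp_le_exp.2 (by linarith)
      have h2 : Real.exp K * Real.exp (-K) = 1 := by rw [← Real.exp_add]; simp
      calc noiseLaw.real {ω | ∀ n, jumpTime ω n ≤ K}
          ≤ noiseLaw.real {ω | Real.exp (-K) ≤ Real.exp (-(jumpTime ω n : ℝ))} := hsub
        _ = Real.exp K * (Real.exp (-K) *
            noiseLaw.real {ω | Real.exp (-K) ≤ Real.exp (-(jumpTime ω n : ℝ))}) := by
            rw [← mul_assoc, h2, one_mul]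
        _ ≤ _ := mul_le_mul_of_nonneg_left hm (Real.exp_pos _).le
    have hlim := (tendsto_pow_atTop_nhds_zero_of_lt_one hc0
      integral_exp_neg_expMeasure).const_mul (Real.exp K)
    rw [mul_zero] at hlim
    have h0 : noiseLaw.real {ω | ∀ n, jumpTime ω n ≤ K} = 0 :=
      le_antisymm (ge_of_tendsto' hlim hbound) measureReal_nonneg
    exact (measureReal_eq_zero_iff).1 h0
  exact ae_all_iff.2 hle

end NoiseLaw

/-! ### Splitting the Dynkin increment over the jumps -/

section Increments

/-- The point of `[s, t]` closest to `x`. -/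
def clip (s t x : ℝ) : ℝ := max s (min x t)

theorem clip_of_le {s t x : ℝ} (hst : s ≤ t) (h : x ≤ s) : clip s t x = s := by
  rw [clip, min_eq_left (h.trans hst), max_eq_left h]

theorem clip_of_ge {s t x : ℝ} (hst : s ≤ t) (h : t ≤ x) : clip s t x = t := by
  rw [clip, min_eq_right h, max_eq_right hst]

theorem clip_mono {s t x y : ℝ} (h : x ≤ y) : clip s t x ≤ clip s t y :=
  max_le_max le_rfl (min_le_min h le_rfl)

theorem abs_clip_sub_clip_le {s t : ℝ} (hst : s ≤ t) (x y : ℝ) :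
    |clip s t x - clip s t y| ≤ t - s := by
  have h : ∀ x, s ≤ clip s t x ∧ clip s t x ≤ t := fun x =>
    ⟨le_max_left _ _, max_le hst (min_le_right _ _)⟩
  rw [abs_le]
  constructor <;> linarith [(h x).1, (h x).2, (h y).1, (h y).2]

theorem measurable_clip (s t : ℝ) : Measurable (clip s t) :=
  measurable_const.max (measurable_id.min measurable_const)

/-- Restriction to [s, t] moves from the endpoints to an indicator, which gives the form ∫₀ᴱ g
needed for the exponential identity. -/
theorem integral_clip (s t u e : ℝ) (he : 0 ≤ e) (f : ℝ → ℝ) :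
    ∫ r in clip s t u..clip s t (u + e), f r =
      ∫ v in (0 : ℝ)..e, (Set.Ioc s t).indicator f (u + v) := by
  rw [intervalIntegral.integral_comp_add_left (fun r => (Set.Ioc s t).indicator f r), add_zero,
    intervalIntegral.integral_of_le (clip_mono (by linarith)),
    intervalIntegral.integral_of_le (by linarith : u ≤ u + e),
    setIntegral_indicator measurableSet_Ioc]
  congr 2
  ext r
  simp only [clip, Set.mem_Ioc, Set.mem_inter_iff, max_lt_iff, le_max_iff, min_lt_iff, le_min_iff]
  constructor
  · rintro ⟨⟨h1, h2⟩, h3⟩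
    rcases h3 with h3 | ⟨h3, h4⟩
    · exact absurd h1 (not_lt.2 h3)
    · refine ⟨⟨?_, h3⟩, h1, h4⟩
      rcases h2 with h2 | h2
      · exact h2
      · exact absurd h2 (not_lt.2 h4)
  · rintro ⟨⟨h1, h2⟩, h3, h4⟩
    exact ⟨⟨h3, Or.inl h1⟩, Or.inr ⟨h2, h4⟩⟩

variable {A : ℝ≥0 → (Opinion → ℝ) → Opinion → ℝ} {l : ℝ}
  {Ψ : ℝ≥0 → Opinion → Opinion → Opinion} {ψ : Opinion → Opinion} {h : Opinion → ℝ} {C : ℝ}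
  {s t : ℝ≥0}

/-- The contribution of the waiting time before the jump with number `n + 1`, and of that jump, to
the increment of the Dynkin martingale between the times `s` and `t`. -/
def jumpIncrement (A : ℝ≥0 → (Opinion → ℝ) → Opinion → ℝ)
    (Ψ : ℝ≥0 → Opinion → Opinion → Opinion) (ψ : Opinion → Opinion) (h : Opinion → ℝ)
    (s t : ℝ≥0) (n : ℕ) (ω : Noise) : ℝ :=
  (if s < jumpTime ω (n + 1) ∧ jumpTime ω (n + 1) ≤ t then
      h (jumpState Ψ ψ ω (n + 1)) - h (jumpState Ψ ψ ω n) else 0)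
    - ∫ r in clip s t (jumpTime ω n)..clip s t (jumpTime ω (n + 1)),
        A r.toNNReal h (jumpState Ψ ψ ω n)

theorem measurable_jumpIncrement (hA : HasBoundedRate A l)
    (hΨ : Measurable fun p : ℝ≥0 × Opinion × Opinion => Ψ p.1 p.2.1 p.2.2) (hψ : Measurable ψ)
    (hh : Measurable h) (hC : ∀ x, |h x| ≤ C) (s t : ℝ≥0) (n : ℕ) :
    Measurable (jumpIncrement A Ψ ψ h s t n) := by
  refine Measurable.sub (Measurable.ite ?_ ?_ measurable_const) ?_
  · have h1 : MeasurableSet {ω : Noise | s < jumpTime ω (n + 1)} :=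
      measurableSet_lt measurable_const (measurable_jumpTime _)
    have h2 : MeasurableSet {ω : Noise | jumpTime ω (n + 1) ≤ t} :=
      measurableSet_le (measurable_jumpTime _) measurable_const
    exact h1.inter h2
  · exact (hh.comp (measurable_jumpState hΨ hψ _)).sub (hh.comp (measurable_jumpState hΨ hψ _))
  · have hc : ∀ k, Measurable fun ω : Noise => clip s t (jumpTime ω k) := fun k =>
      (measurable_clip s t).comp (measurable_coe_nnreal_real.comp (measurable_jumpTime k))
    exact measurable_intervalIntegral_endpoints (hc n) (hc (n + 1))
      (f := fun p : Noise × ℝ => A p.2.toNNReal h (jumpState Ψ ψ p.1 n))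
      ((hA.2 h C hh hC).1.comp (measurable_snd.prodMk
        ((measurable_jumpState hΨ hψ n).comp measurable_fst)))

theorem abs_jumpIncrement_le (hA : HasBoundedRate A l) (hh : Measurable h) (hC : ∀ x, |h x| ≤ C)
    (hst : s ≤ t) (n : ℕ) (ω : Noise) :
    |jumpIncrement A Ψ ψ h s t n ω| ≤ 2 * C + l * C * (t - s) := by
  have hC₀ : 0 ≤ C := (abs_nonneg _).trans (hC 0)
  refine (abs_sub _ _).trans (add_le_add ?_ ?_)
  · split_ifs
    · have h1 := hC (jumpState Ψ ψ ω (n + 1))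
      have h2 := hC (jumpState Ψ ψ ω n)
      exact (abs_sub _ _).trans (by linarith)
    · simpa using hC₀
  · rw [← Real.norm_eq_abs]
    refine (intervalIntegral.norm_integral_le_of_norm_le_const
      fun r _ => (hA.2 h C hh hC).2 _ _).trans ?_
    exact mul_le_mul_of_nonneg_left (abs_clip_sub_clip_le hst _ _)
      (mul_nonneg hA.1 hC₀)

theorem jumpIncrement_of_le (hst : s ≤ t) {n : ℕ} {ω : Noise} (hn : jumpTime ω (n + 1) ≤ s) :
    jumpIncrement A Ψ ψ h s t n ω = 0 := by
  have hst' : (s : ℝ) ≤ t := hst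
  have h1 : (jumpTime ω (n + 1) : ℝ) ≤ s := hn
  have h2 : (jumpTime ω n : ℝ) ≤ s := (jumpTime_mono ω (Nat.le_succ n)).trans hn
  rw [jumpIncrement, if_neg (fun h => absurd h.1 (not_lt.2 hn)), clip_of_le hst' h1,
    clip_of_le hst' h2]
  simp

/-- Given the first `n` jumps, the increment due to the next jump is centered. -/
theorem integral_jumpIncrement_update (hA : HasBoundedRate A l)
    (hΨ : Measurable fun p : ℝ≥0 × Opinion × Opinion => Ψ p.1 p.2.1 p.2.2) (hψ : Measurable ψ)
    (hAΨ : ∀ t h z, IsBoundedMeasurable h → A t h z = 2 * ((∫ u, h (Ψ t z u)) - h z))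
    (hh : Measurable h) (hC : ∀ x, |h x| ≤ C) (hst : s ≤ t) (n : ℕ) (ω : Noise) :
    ∫ e, jumpIncrement A Ψ ψ h s t n (Function.update ω (n + 1) e)
      ∂((expMeasure 2).prod (volume : Measure Opinion)) = 0 := by
  set T : ℝ≥0 := jumpTime ω n with hT
  set z : Opinion := jumpState Ψ ψ ω n with hz
  set g : ℝ → ℝ := fun v =>
    (Set.Ioc (s : ℝ) t).indicator (fun r => A r.toNNReal h z) (T + v) with hg
  have hgm : Measurable g := by
    have h1 : Measurable fun r : ℝ => A r.toNNReal h z :=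
      (hA.2 h C hh hC).1.comp (measurable_id.prodMk measurable_const)
    exact (h1.indicator measurableSet_Ioc).comp (measurable_const_add _)
  have hgC : ∀ v, |g v| ≤ l * C := by
    intro v
    by_cases hv : (T : ℝ) + v ∈ Set.Ioc (s : ℝ) t
    · simp only [hg, Set.indicator_of_mem hv]
      exact (hA.2 h C hh hC).2 _ _
    · simp only [hg, Set.indicator_of_notMem hv, abs_zero]
      exact mul_nonneg hA.1 ((abs_nonneg _).trans (hC 0))
  set F : ℝ × Opinion → ℝ := fun e => if s < T + e.1.toNNReal ∧ T + e.1.toNNReal ≤ t then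
    h (Ψ (T + e.1.toNNReal) z e.2) - h z else 0 with hF
  set G : ℝ → ℝ := fun e => ∫ v in (0 : ℝ)..(e.toNNReal : ℝ), g v with hG
  have hD : ∀ e, jumpIncrement A Ψ ψ h s t n (Function.update ω (n + 1) e) = F e - G e.1 := by
    intro e
    rw [jumpIncrement, jumpState, jumpTime, jumpTime_update le_rfl, jumpState_update le_rfl,
      Function.update_self, NNReal.coe_add, integral_clip _ _ _ _ (NNReal.coe_nonneg _)]
  have hTm : Measurable fun e : ℝ × Opinion => T + e.1.toNNReal :=
    (measurable_real_toNNReal.comp measurable_fst).const_add T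
  have hFm : Measurable F := by
    refine Measurable.ite ?_ ?_ measurable_const
    · have h1 : MeasurableSet {e : ℝ × Opinion | s < T + e.1.toNNReal} :=
        measurableSet_lt measurable_const hTm
      have h2 : MeasurableSet {e : ℝ × Opinion | T + e.1.toNNReal ≤ t} :=
        measurableSet_le hTm measurable_const
      exact h1.inter h2
    · exact (hh.comp (hΨ.comp (hTm.prodMk (measurable_const.prodMk measurable_snd)))).sub_const _
  have hFi : Integrable F ((expMeasure 2).prod (volume : Measure Opinion)) := by
    refine IsBoundedMeasurable.integrable ⟨hFm, 2 * C, fun e => ?_⟩ _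
    simp only [hF]
    split_ifs
    · exact (abs_sub _ _).trans (by linarith [hC (Ψ (T + e.1.toNNReal) z e.2), hC z])
    · have := (abs_nonneg _).trans (hC 0)
      simpa using this
  have hGi : Integrable (fun e : ℝ × Opinion => G e.1)
      ((expMeasure 2).prod (volume : Measure Opinion)) := by
    -- `G` is integrable as the difference of two bounded functions.
    have h1 : ∀ e, G e.1 = F e - jumpIncrement A Ψ ψ h s t n (Function.update ω (n + 1) e) :=
      fun e => by rw [hD]; ring
    simp_rw [h1]
    refine hFi.sub (IsBoundedMeasurable.integrable
      ⟨(measurable_jumpIncrement hA hΨ hψ hh hC s t n).comp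
        ((measurable_update (n + 1)).comp measurable_prodMk_left), _, fun e =>
          abs_jumpIncrement_le hA hh hC hst n _⟩ _)
  simp_rw [hD]
  rw [integral_sub hFi hGi, integral_prod _ hFi, integral_fun_fst G]
  -- Averaging over the mark turns the jump of `h` into half the generator by `hAΨ`. What remains is
  -- 2 E∫₀ᴱ g = E g(E).
  have hin : ∀ e : ℝ, ∫ u, F (e, u) = g (e.toNNReal : ℝ) / 2 := by
    intro e
    by_cases hc : s < T + e.toNNReal ∧ T + e.toNNReal ≤ t
    · have hmem : (T : ℝ) + (e.toNNReal : ℝ) ∈ Set.Ioc (s : ℝ) t := by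
        exact_mod_cast hc
      have hi : Integrable (fun u => h (Ψ (T + e.toNNReal) z u)) (volume : Measure Opinion) :=
        IsBoundedMeasurable.integrable
          ⟨hh.comp (hΨ.comp (measurable_const.prodMk (measurable_const.prodMk measurable_id))), C,
            fun _ => hC _⟩ _
      simp only [hF, if_pos hc, hg]
      rw [Set.indicator_of_mem hmem, ← NNReal.coe_add, Real.toNNReal_coe,
        hAΨ _ _ _ ⟨hh, C, hC⟩, integral_sub hi (integrable_const _)]
      simp
    · have hmem : (T : ℝ) + (e.toNNReal : ℝ) ∉ Set.Ioc (s : ℝ) t := by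
        intro h
        exact hc (by exact_mod_cast h)
      simp only [hF, if_neg hc, hg]
      rw [Set.indicator_of_notMem hmem]
      simp
  simp_rw [hin]
  rw [integral_div, ← two_mul_integral_expMeasure_integral hgm hgC]
  simp [hG]

/-- The increments add up to the increment of the Dynkin martingale of the stopped process. -/
theorem sum_jumpIncrement (hA : HasBoundedRate A l) (hh : Measurable h) (hC : ∀ x, |h x| ≤ C)
    (hst : s ≤ t) (ω : Noise) (n : ℕ) :
    ∑ k ∈ Finset.range n, jumpIncrement A Ψ ψ h s t k ω =
      h (pathUpTo Ψ ψ ω n t) - h (pathUpTo Ψ ψ ω n s)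
        - ∫ r in (s : ℝ)..clip s t (jumpTime ω n), A r.toNNReal h (pathUpTo Ψ ψ ω n r.toNNReal) := by
  induction n with
  | zero =>
    have : ((jumpTime ω 0 : ℝ≥0) : ℝ) ≤ s := by
      rw [jumpTime]
      exact s.coe_nonneg
    rw [clip_of_le (NNReal.coe_le_coe.2 hst) this]
    simp [pathUpTo]
  | succ n ih =>
    have hst' : (s : ℝ) ≤ t := hst
    have hT : (jumpTime ω n : ℝ) ≤ jumpTime ω (n + 1) := jumpTime_mono ω (Nat.le_succ n)
    have hii : ∀ a b : ℝ, IntervalIntegrable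
        (fun r => A r.toNNReal h (pathUpTo Ψ ψ ω (n + 1) r.toNNReal)) volume a b := fun a b =>
      intervalIntegrable_path hA ⟨hh, C, hC⟩ (jumpPathUpTo Ψ ψ (n + 1) ω) a b
    have hlt : ∀ r : ℝ, r < clip s t (jumpTime ω (n + 1)) → (s : ℝ) ≤ r →
        r.toNNReal < jumpTime ω (n + 1) := by
      intro r hr hsr
      rcases lt_max_iff.1 hr with h1 | h1
      · exact absurd h1 (not_lt.2 hsr)
      · have h2 : r < jumpTime ω (n + 1) := h1.trans_le (min_le_left _ _)
        rw [← NNReal.coe_lt_coe, Real.coe_toNNReal r (s.coe_nonneg.trans hsr)]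
        exact h2
    have hc0 : (s : ℝ) ≤ clip s t (jumpTime ω n) := le_max_left _ _
    have e1 : ∫ r in (s : ℝ)..clip s t (jumpTime ω n),
        A r.toNNReal h (pathUpTo Ψ ψ ω (n + 1) r.toNNReal) =
        ∫ r in (s : ℝ)..clip s t (jumpTime ω n),
          A r.toNNReal h (pathUpTo Ψ ψ ω n r.toNNReal) := by
      refine intervalIntegral.integral_congr_uIoo fun r hr => ?_
      rw [Set.uIoo_of_le hc0] at hr
      rw [pathUpTo_succ_of_lt (hlt r (hr.2.trans_le (clip_mono hT)) hr.1.le)]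
    have e2 : ∫ r in clip s t (jumpTime ω n)..clip s t (jumpTime ω (n + 1)),
        A r.toNNReal h (pathUpTo Ψ ψ ω (n + 1) r.toNNReal) =
        ∫ r in clip s t (jumpTime ω n)..clip s t (jumpTime ω (n + 1)),
          A r.toNNReal h (jumpState Ψ ψ ω n) := by
      -- The interval must be open: at its right end the jump may already have been made.
      refine intervalIntegral.integral_congr_uIoo fun r hr => ?_
      rw [Set.uIoo_of_le (clip_mono hT)] at hr
      rw [pathUpTo_succ_of_lt (hlt r hr.2 (hc0.trans hr.1.le)), pathUpTo_of_le]
      have h1 : (jumpTime ω n : ℝ) ≤ r := by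
        by_contra hcon
        have h2 := hr.1
        have h3 := hr.2
        simp only [clip, max_lt_iff, min_lt_iff, lt_max_iff, lt_min_iff] at h2 h3
        rcases h2.2 with h4 | h4
        · exact hcon h4.le
        · rcases h3 with h5 | h5
          · linarith
          · linarith [h5.2]
      rw [← NNReal.coe_le_coe, Real.coe_toNNReal r ((NNReal.coe_nonneg _).trans h1)]
      exact h1
    rw [Finset.sum_range_succ, ih, ← intervalIntegral.integral_add_adjacent_intervals
      (hii _ (clip s t (jumpTime ω n))) (hii _ _), e1, e2, jumpIncrement]
    have hP : ∀ u : ℝ≥0, h (pathUpTo Ψ ψ ω (n + 1) u) = if jumpTime ω (n + 1) ≤ u then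
        h (jumpState Ψ ψ ω (n + 1)) else h (pathUpTo Ψ ψ ω n u) := by
      intro u
      exact apply_ite h _ _ _
    have hQ : ∀ u : ℝ≥0, jumpTime ω (n + 1) ≤ u →
        pathUpTo Ψ ψ ω n u = jumpState Ψ ψ ω n := fun u hu =>
      pathUpTo_of_le ((jumpTime_mono ω (Nat.le_succ n)).trans hu)
    rw [hP, hP]
    by_cases h1 : jumpTime ω (n + 1) ≤ s
    · rw [if_neg (fun h => absurd h.1 (not_lt.2 h1)), if_pos h1, if_pos (h1.trans hst), hQ s h1,
        hQ t (h1.trans hst)]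
      ring
    · by_cases h2 : jumpTime ω (n + 1) ≤ t
      · rw [if_pos ⟨not_le.1 h1, h2⟩, if_neg h1, if_pos h2, hQ t h2]
        ring
      · rw [if_neg (fun h => h2 h.2), if_neg h1, if_neg h2]
        ring

end Increments

/-! ### The jump process solves the martingale problem -/

section JumpLaw

theorem mem_iff_of_eq_until {s : ℝ≥0} {B : Set (SkorokhodSpace Opinion)}
    (hB : MeasurableSet[canonicalFiltration s] B) {x y : SkorokhodSpace Opinion}
    (h : ∀ u ≤ s, coord u x = coord u y) : x ∈ B ↔ y ∈ B := by
  have e : canonicalFiltration s =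
      MeasurableSpace.comap (fun x (j : Set.Iic s) => coord j x) inferInstance :=
    Filtration.natural_eq_comap _ _ s
  rw [e] at hB
  obtain ⟨B', -, rfl⟩ := hB
  have : (fun j : Set.Iic s => coord j x) = fun j : Set.Iic s => coord j y :=
    funext fun j => h j j.2
  simp only [Set.mem_preimage, this]

variable {A : ℝ≥0 → (Opinion → ℝ) → Opinion → ℝ} {l : ℝ}
  {Ψ : ℝ≥0 → Opinion → Opinion → Opinion} {ψ : Opinion → Opinion} {h : Opinion → ℝ} {C : ℝ}
  {s t : ℝ≥0}

/-- If jump `n + 1` occurs by time `s`, its increment is `0`. Otherwise the path up to `s` uses only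
the first `n` jumps, so membership in `B` is fixed when noise `n + 1` is integrated out, and the
increment is centered. -/
theorem integral_indicator_mul_jumpIncrement (hA : HasBoundedRate A l)
    (hΨ : Measurable fun p : ℝ≥0 × Opinion × Opinion => Ψ p.1 p.2.1 p.2.2) (hψ : Measurable ψ)
    (hAΨ : ∀ t h z, IsBoundedMeasurable h → A t h z = 2 * ((∫ u, h (Ψ t z u)) - h z))
    (hh : Measurable h) (hC : ∀ x, |h x| ≤ C) (hst : s ≤ t) {B : Set (SkorokhodSpace Opinion)}
    (hB : MeasurableSet[canonicalFiltration s] B) (n : ℕ) :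
    ∫ ω, B.indicator 1 (jumpPath Ψ ψ ω) * jumpIncrement A Ψ ψ h s t n ω ∂noiseLaw = 0 := by
  have hB' : MeasurableSet B := canonicalFiltration.le s B hB
  have hD := measurable_jumpIncrement hA hΨ hψ hh hC s t n
  have e1 : ∀ᵐ ω ∂noiseLaw,
      B.indicator (1 : SkorokhodSpace Opinion → ℝ) (jumpPath Ψ ψ ω) * jumpIncrement A Ψ ψ h s t n ω =
        B.indicator (1 : SkorokhodSpace Opinion → ℝ) (jumpPathUpTo Ψ ψ n ω) * jumpIncrement A Ψ ψ h s t n ω := by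
    filter_upwards [ae_nonExplosive] with ω hω
    rcases le_or_gt (jumpTime ω (n + 1)) s with hn | hn
    · rw [jumpIncrement_of_le hst hn, mul_zero, mul_zero]
    · have hiff : jumpPath Ψ ψ ω ∈ B ↔ jumpPathUpTo Ψ ψ n ω ∈ B :=
        mem_iff_of_eq_until hB fun u hu => pathFun_eq hω (hu.trans_lt hn)
      by_cases hm : jumpPath Ψ ψ ω ∈ B
      · rw [Set.indicator_of_mem hm, Set.indicator_of_mem (hiff.1 hm)]
        rfl
      · rw [Set.indicator_of_notMem hm, Set.indicator_of_notMem (fun h => hm (hiff.2 h))]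
  have hind : ∀ x, |B.indicator (1 : SkorokhodSpace Opinion → ℝ) x| ≤ 1 := fun x => by
    by_cases hx : x ∈ B <;> simp [hx]
  have hF : Measurable fun ω => B.indicator (1 : SkorokhodSpace Opinion → ℝ)
      (jumpPathUpTo Ψ ψ n ω) * jumpIncrement A Ψ ψ h s t n ω :=
    ((measurable_one.indicator hB').comp (measurable_jumpPathUpTo hΨ hψ n)).mul hD
  rw [integral_congr_ae e1, integral_noiseLaw_update (n + 1) hF
    (K := 1 * (2 * C + l * C * (t - s))) fun ω => ?_]
  · simp_rw [jumpPathUpTo_update, integral_const_mul,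
      integral_jumpIncrement_update hA hΨ hψ hAΨ hh hC hst n]
    simp
  · rw [abs_mul]
    exact mul_le_mul (hind _) (abs_jumpIncrement_le hA hh hC hst n ω) (abs_nonneg _) zero_le_one

/-- Without explosion the partial sums are constant as soon as T_n exceeds `t`. -/
theorem tendsto_sum_jumpIncrement (hA : HasBoundedRate A l) (hh : Measurable h)
    (hC : ∀ x, |h x| ≤ C) (hst : s ≤ t) {ω : Noise} (hω : NonExplosive ω) :
    Tendsto (fun n => ∑ k ∈ Finset.range n, jumpIncrement A Ψ ψ h s t k ω) atTop
      (𝓝 (dynkin A h t (jumpPath Ψ ψ ω) - dynkin A h s (jumpPath Ψ ψ ω))) := by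
  obtain ⟨N, hN⟩ := hω.exists_lt t
  refine tendsto_const_nhds.congr' ?_
  filter_upwards [eventually_ge_atTop (N + 1)] with n hn
  have hT : t < jumpTime ω n := hN.trans_le (jumpTime_mono ω hn)
  have hpath : ∀ u ≤ t, coord u (jumpPath Ψ ψ ω) = pathUpTo Ψ ψ ω n u := fun u hu =>
    pathFun_eq hω ((hu.trans_lt hT).trans_le (jumpTime_mono ω (Nat.le_succ n)))
  have hst' : (s : ℝ) ≤ t := hst
  have hT' : (t : ℝ) ≤ jumpTime ω n := hT.le
  rw [sum_jumpIncrement hA hh hC hst, dynkin_sub hA ⟨hh, C, hC⟩, hpath t le_rfl, hpath s hst,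
    clip_of_ge hst' hT']
  congr 1
  refine intervalIntegral.integral_congr fun r hr => ?_
  rw [Set.uIcc_of_le hst'] at hr
  have hr' : r.toNNReal ≤ t := Real.toNNReal_le_iff_le_coe.2 hr.2
  simp only [hpath _ hr']

/-- The telescoped form gives a bound independent of `n`, which serves as the dominating constant
for the limit. -/
theorem abs_sum_jumpIncrement_le (hA : HasBoundedRate A l) (hh : Measurable h)
    (hC : ∀ x, |h x| ≤ C) (hst : s ≤ t) (ω : Noise) (n : ℕ) :
    |∑ k ∈ Finset.range n, jumpIncrement A Ψ ψ h s t k ω| ≤ 2 * C + l * C * (t - s) := by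
  have hst' : (s : ℝ) ≤ t := hst
  rw [sum_jumpIncrement hA hh hC hst]
  refine (abs_sub _ _).trans (add_le_add ?_ ?_)
  · have h1 := hC (pathUpTo Ψ ψ ω n t)
    have h2 := hC (pathUpTo Ψ ψ ω n s)
    exact (abs_sub _ _).trans (by linarith)
  · rw [← Real.norm_eq_abs]
    refine (intervalIntegral.norm_integral_le_of_norm_le_const
      fun r _ => (hA.2 h C hh hC).2 _ _).trans ?_
    refine mul_le_mul_of_nonneg_left ?_ (mul_nonneg hA.1 ((abs_nonneg _).trans (hC 0)))
    have := abs_clip_sub_clip_le hst' (jumpTime ω n) s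
    rwa [clip_of_le hst' le_rfl] at this

theorem integral_indicator_mul_dynkin_sub (hA : HasBoundedRate A l)
    (hΨ : Measurable fun p : ℝ≥0 × Opinion × Opinion => Ψ p.1 p.2.1 p.2.2) (hψ : Measurable ψ)
    (hAΨ : ∀ t h z, IsBoundedMeasurable h → A t h z = 2 * ((∫ u, h (Ψ t z u)) - h z))
    (hh : Measurable h) (hC : ∀ x, |h x| ≤ C) (hst : s ≤ t) {B : Set (SkorokhodSpace Opinion)}
    (hB : MeasurableSet[canonicalFiltration s] B) :
    ∫ ω, B.indicator 1 (jumpPath Ψ ψ ω) *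
      (dynkin A h t (jumpPath Ψ ψ ω) - dynkin A h s (jumpPath Ψ ψ ω)) ∂noiseLaw = 0 := by
  have hB' : MeasurableSet B := canonicalFiltration.le s B hB
  have hind : ∀ x, |B.indicator (1 : SkorokhodSpace Opinion → ℝ) x| ≤ 1 := fun x => by
    by_cases hx : x ∈ B <;> simp [hx]
  have hbm : Measurable fun ω => B.indicator (1 : SkorokhodSpace Opinion → ℝ) (jumpPath Ψ ψ ω) :=
    (measurable_one.indicator hB').comp (measurable_jumpPath hΨ hψ)
  have hD := measurable_jumpIncrement hA hΨ hψ hh hC s t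
  have hlim := tendsto_integral_of_dominated_convergence (μ := noiseLaw)
    (F := fun n ω => B.indicator (1 : SkorokhodSpace Opinion → ℝ) (jumpPath Ψ ψ ω) *
      ∑ k ∈ Finset.range n, jumpIncrement A Ψ ψ h s t k ω)
    (f := fun ω => B.indicator (1 : SkorokhodSpace Opinion → ℝ) (jumpPath Ψ ψ ω) *
      (dynkin A h t (jumpPath Ψ ψ ω) - dynkin A h s (jumpPath Ψ ψ ω)))
    (fun _ => 1 * (2 * C + l * C * (t - s)))
    (fun n => (hbm.mul (Finset.measurable_fun_sum _ fun k _ => hD k)).aestronglyMeasurable)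
    (integrable_const _)
    (fun n => Eventually.of_forall fun ω => by
      rw [norm_mul]
      exact mul_le_mul (hind _) (abs_sum_jumpIncrement_le hA hh hC hst ω n) (norm_nonneg _)
        zero_le_one)
    (by
      filter_upwards [ae_nonExplosive] with ω hω
      exact (tendsto_sum_jumpIncrement hA hh hC hst hω).const_mul _)
  refine tendsto_nhds_unique hlim ?_
  refine tendsto_const_nhds.congr fun n => ?_
  simp_rw [Finset.mul_sum]
  rw [integral_finsetSum _ fun k _ => ?_]
  · exact (Finset.sum_eq_zero fun k _ =>
      integral_indicator_mul_jumpIncrement hA hΨ hψ hAΨ hh hC hst hB k).symm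
  · refine Integrable.of_bound (hbm.mul (hD k)).aestronglyMeasurable
      (1 * (2 * C + l * C * (t - s))) (Eventually.of_forall fun ω => ?_)
    rw [norm_mul]
    exact mul_le_mul (hind _) (abs_jumpIncrement_le hA hh hC hst k ω) (norm_nonneg _) zero_le_one

/-- The law of the jump process. -/
def jumpLaw (hΨ : Measurable fun p : ℝ≥0 × Opinion × Opinion => Ψ p.1 p.2.1 p.2.2)
    (hψ : Measurable ψ) : ProbabilityMeasure (SkorokhodSpace Opinion) :=
  ⟨noiseLaw.map (jumpPath Ψ ψ),
    Measure.isProbabilityMeasure_map (measurable_jumpPath hΨ hψ).aemeasurable⟩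

theorem integrable_dynkin (hA : HasBoundedRate A l) (hh : IsBoundedMeasurable h) (t : ℝ≥0)
    (Q : ProbabilityMeasure (SkorokhodSpace Opinion)) :
    Integrable (dynkin A h t) (Q : Measure (SkorokhodSpace Opinion)) := by
  have hm := (measurable_dynkin hA hh t).mono (canonicalFiltration.le t) le_rfl
  obtain ⟨hh, C, hC⟩ := hh
  refine Integrable.of_bound hm.aestronglyMeasurable (2 * C + l * C * |(t : ℝ) - 0|)
    (Eventually.of_forall fun x => ?_)
  refine (abs_sub _ _).trans (add_le_add ?_ ?_)
  · have h1 := hC (coord t x)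
    have h2 := hC (coord 0 x)
    exact (abs_sub _ _).trans (by linarith)
  · rw [← Real.norm_eq_abs]
    exact intervalIntegral.norm_integral_le_of_norm_le_const fun r _ => (hA.2 h C hh hC).2 _ _

theorem martingale_jumpLaw (hA : HasBoundedRate A l)
    (hΨ : Measurable fun p : ℝ≥0 × Opinion × Opinion => Ψ p.1 p.2.1 p.2.2) (hψ : Measurable ψ)
    (hAΨ : ∀ t h z, IsBoundedMeasurable h → A t h z = 2 * ((∫ u, h (Ψ t z u)) - h z))
    (hh : IsBoundedMeasurable h) :
    Martingale (dynkin A h) canonicalFiltration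
      (jumpLaw hΨ hψ : Measure (SkorokhodSpace Opinion)) := by
  refine ⟨fun t => (measurable_dynkin hA hh t).stronglyMeasurable, fun s t hst => ?_⟩
  symm
  refine ae_eq_condExp_of_forall_setIntegral_eq (canonicalFiltration.le s)
    (integrable_dynkin hA hh t _) (fun _ _ _ => (integrable_dynkin hA hh s _).integrableOn)
    (fun B hB _ => ?_) (measurable_dynkin hA hh s).stronglyMeasurable.aestronglyMeasurable
  have hB' : MeasurableSet B := canonicalFiltration.le s B hB
  have hm : ∀ u, Measurable (dynkin A h u) := fun u =>
    (measurable_dynkin hA hh u).mono (canonicalFiltration.le u) le_rfl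
  have hi : ∀ u, Integrable (dynkin A h u) (jumpLaw hΨ hψ : Measure (SkorokhodSpace Opinion)) :=
    fun u => integrable_dynkin hA hh u _
  symm
  rw [← sub_eq_zero, ← integral_sub (hi t).integrableOn (hi s).integrableOn,
    ← integral_indicator hB']
  have e : ∀ x, B.indicator (fun x => dynkin A h t x - dynkin A h s x) x =
      B.indicator 1 x * (dynkin A h t x - dynkin A h s x) := by
    intro x
    by_cases hx : x ∈ B <;> simp [hx]
  simp_rw [e]
  obtain ⟨hh, C, hC⟩ := hh
  have e2 : (jumpLaw hΨ hψ : Measure (SkorokhodSpace Opinion)) =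
      noiseLaw.map (jumpPath Ψ ψ) := rfl
  have hfm : Measurable fun x => B.indicator (1 : SkorokhodSpace Opinion → ℝ) x *
      (dynkin A h t x - dynkin A h s x) :=
    (measurable_one.indicator hB').mul ((hm t).sub (hm s))
  rw [e2, integral_map (measurable_jumpPath hΨ hψ).aemeasurable hfm.aestronglyMeasurable]
  exact integral_indicator_mul_dynkin_sub hA hΨ hψ hAΨ hh hC hst hB

/-- The first waiting time is almost surely positive, so no jump alters the initial state ψ(u₀). -/
theorem map_coord_zero_jumpLaw
    (hΨ : Measurable fun p : ℝ≥0 × Opinion × Opinion => Ψ p.1 p.2.1 p.2.2) (hψ : Measurable ψ) :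
    (jumpLaw hΨ hψ : Measure (SkorokhodSpace Opinion)).map (coord 0) =
      (volume : Measure Opinion).map ψ := by
  have e2 : (jumpLaw hΨ hψ : Measure (SkorokhodSpace Opinion)) =
      noiseLaw.map (jumpPath Ψ ψ) := rfl
  rw [e2, Measure.map_map (measurable_coord 0) (measurable_jumpPath hΨ hψ)]
  have hev : ∀ i : ℕ, MeasurePreserving (fun ω : Noise => ω i) noiseLaw
      ((expMeasure 2).prod (volume : Measure Opinion)) := fun i =>
    measurePreserving_eval_infinitePi
      (fun _ : ℕ => (expMeasure 2).prod (volume : Measure Opinion)) i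
  have hpos : ∀ᵐ ω ∂noiseLaw, 0 < (ω 1).1 :=
    ((measurePreserving_fst (μ := expMeasure 2) (ν := (volume : Measure Opinion))).comp
      (hev 1)).quasiMeasurePreserving.ae ae_pos_expMeasure
  have e1 : coord 0 ∘ jumpPath Ψ ψ =ᵐ[noiseLaw] ψ ∘ Prod.snd ∘ fun ω => ω 0 := by
    filter_upwards [ae_nonExplosive, hpos] with ω hω h1
    have : (0 : ℝ≥0) < jumpTime ω (0 + 1) := by
      rw [jumpTime, jumpTime, zero_add]
      exact Real.toNNReal_pos.2 h1
    exact pathFun_eq hω this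
  have h2 : MeasurePreserving (Prod.snd ∘ fun ω : Noise => ω 0) noiseLaw
      (volume : Measure Opinion) :=
    (measurePreserving_snd (μ := expMeasure 2) (ν := (volume : Measure Opinion))).comp (hev 0)
  rw [Measure.map_congr e1, ← Measure.map_map hψ h2.measurable, h2.map_eq]

theorem isMarkovLaw_jumpLaw (hA : HasBoundedRate A l)
    (hΨ : Measurable fun p : ℝ≥0 × Opinion × Opinion => Ψ p.1 p.2.1 p.2.2) (hψ : Measurable ψ)
    (hAΨ : ∀ t h z, IsBoundedMeasurable h → A t h z = 2 * ((∫ u, h (Ψ t z u)) - h z))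
    {m₀ : ProbabilityMeasure Opinion} (h0 : (volume : Measure Opinion).map ψ = m₀) :
    IsMarkovLaw A m₀ (jumpLaw hΨ hψ) where
  initial := (map_coord_zero_jumpLaw hΨ hψ).trans h0
  markov _ hh _ _ hst :=
    markov_of_martingale hA (fun _ hg => martingale_jumpLaw hA hΨ hψ hAΨ hg) hh hst
  generator _ hh := martingale_jumpLaw hA hΨ hψ hAΨ hh

theorem IsSolution.exists_isMarkovLaw {w : Opinion} {Δ : ℝ} {m₀ : ProbabilityMeasure Opinion}
    {m : ℝ≥0 → ProbabilityMeasure Opinion} (hm : IsSolution w Δ m₀ m) :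
    ∃ Q : ProbabilityMeasure (SkorokhodSpace Opinion),
      IsMarkovLaw (fun t => Deffuant.generator w Δ (m t)) m₀ Q := by
  let κ : Kernel ℝ≥0 Opinion := ⟨fun t => (m t : Measure Opinion), hm.measurable⟩
  have : IsMarkovKernel κ := ⟨fun t => (inferInstance :
    IsProbabilityMeasure (m t : Measure Opinion))⟩
  -- A jointly measurable Y_t(u) carries the uniform law to m(t) for every t. The jump map is then z
  -- ↦ J(z, Y_t(u)), and Y_0 supplies the initial state.
  obtain ⟨Y, hY, hYκ⟩ := κ.exists_measurable_map_eq_unitInterval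
  have hYm : ∀ t, (volume : Measure Opinion).map (Y t) = (m t : Measure Opinion) := hYκ
  have hYt : ∀ t, Measurable (Y t) := fun t => hY.comp measurable_prodMk_left
  have hΨ : Measurable fun p : ℝ≥0 × Opinion × Opinion => jump w Δ p.2.1 (Y p.1 p.2.2) :=
    (measurable_jump w Δ).comp ((measurable_fst.comp measurable_snd).prodMk
      (hY.comp (measurable_fst.prodMk (measurable_snd.comp measurable_snd))))
  refine ⟨jumpLaw (Ψ := fun t z u => jump w Δ z (Y t u)) hΨ (hYt 0),
    isMarkovLaw_jumpLaw hm.hasBoundedRate hΨ (hYt 0) (fun t h z hh => ?_)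
      ((hYm 0).trans (by rw [hm.1]))⟩
  obtain ⟨hh, C, hC⟩ := hh
  rw [generator_eq hh hC, ← hYm t, integral_map (hYt t).aemeasurable]
  exact ((measurable_comp_jump hh).comp measurable_prodMk_left).aestronglyMeasurable

end JumpLaw

end Deffuant

end

theorem mainTheorem4 (w : unitInterval) (hw₀ : 0 < w) (hw₁ : w < 1)
    (Δ : ℝ) (hΔ₀ : 0 < Δ) (hΔ₁ : Δ ≤ 1) :
    -- existence and uniqueness for Problem 1
    (∀ m₀ : ProbabilityMeasure Deffuant.Opinion,
      ∃! m : ℝ≥0 → ProbabilityMeasure Deffuant.Opinion, Deffuant.IsSolution w Δ m₀ m) ∧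
    -- continuity in time, in total variation
    (∀ (m₀ : ProbabilityMeasure Deffuant.Opinion)
      (m : ℝ≥0 → ProbabilityMeasure Deffuant.Opinion), Deffuant.IsSolution w Δ m₀ m →
      ∀ t : ℝ≥0, Tendsto (fun s => Deffuant.tvDist (m s) (m t)) (𝓝 t) (𝓝 0)) ∧
    -- continuity in the initial value, in total variation, uniformly on bounded time sets
    (∀ (m₀ : ProbabilityMeasure Deffuant.Opinion)
      (m : ℝ≥0 → ProbabilityMeasure Deffuant.Opinion), Deffuant.IsSolution w Δ m₀ m →
      ∀ T : ℝ≥0, ∀ ε : ℝ, 0 < ε → ∃ δ : ℝ, 0 < δ ∧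
        ∀ (m₀' : ProbabilityMeasure Deffuant.Opinion)
          (m' : ℝ≥0 → ProbabilityMeasure Deffuant.Opinion), Deffuant.IsSolution w Δ m₀' m' →
          Deffuant.tvDist m₀' m₀ < δ → ∀ t : ℝ≥0, t ≤ T → Deffuant.tvDist (m' t) (m t) < ε) ∧
    -- the law of the inhomogeneous Markov process, and its marginals
    (∀ (m₀ : ProbabilityMeasure Deffuant.Opinion)
      (m : ℝ≥0 → ProbabilityMeasure Deffuant.Opinion), Deffuant.IsSolution w Δ m₀ m →
      (∃! Q : ProbabilityMeasure (Deffuant.SkorokhodSpace Deffuant.Opinion),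
        Deffuant.IsMarkovLaw (fun t => Deffuant.generator w Δ (m t)) m₀ Q) ∧
      ∀ Q : ProbabilityMeasure (Deffuant.SkorokhodSpace Deffuant.Opinion),
        Deffuant.IsMarkovLaw (fun t => Deffuant.generator w Δ (m t)) m₀ Q →
        ∀ t : ℝ≥0, (Q : Measure (Deffuant.SkorokhodSpace Deffuant.Opinion)).map
          (Deffuant.coord t) = (m t : Measure Deffuant.Opinion)) := by
  refine ⟨fun m₀ => ⟨Deffuant.wildSolution w Δ m₀, Deffuant.isSolution_wildSolution w Δ m₀,
    fun m hm => hm.unique (Deffuant.isSolution_wildSolution w Δ m₀)⟩,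
    fun m₀ m hm t => hm.tendsto_tvDist t, fun m₀ m hm T ε hε => hm.exists_tvDist_lt T hε,
    fun m₀ m hm => ⟨?_, fun Q hQ t => hQ.map_coord hm t⟩⟩
  obtain ⟨Q, hQ⟩ := hm.exists_isMarkovLaw
  exact ⟨Q, hQ, fun Q' hQ' => hQ'.unique hm.hasBoundedRate hQ⟩
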